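/- Graphs are finite, nonempty, and may have loops and parallel edges; a loop contributes $2$ to the degree of its vertex, and a graph is \emph{cubic} if every vertex has degree $3$. A \emph{circuit} is a connected $2$-regular graph (a vertex with a loop is a circuit). A graph $G$ is \emph{cyclically $4$-edge-connected} if for every set $S\subseteq E(G)$ with $|S|<4$, no two different components of $G-S$ both contain a circuit. A graph is \emph{$3$-edge-colorable} if it is loopless and its edges can be colored with three colors so that any two distinct edges with a common end receive different colors. A cubic graph $H$ is a \emph{spanning minor} of a cubic graph $G$ if some subdivision of $H$ is (isomorphic to) a spanning subgraph of $G$. \textbf{Theorem.} Let $G$ be a cyclically $4$-edge-connected cubic graph. Then $G$ is bridgeless and contains a connected $3$-edge-colorable cubic graph $H$ as a spanning minor. That is, every cyclically $4$-edge-connected cubic graph satisfies the hypothesis of the conjecture of Häggkvist and Markström which asserts that every bridgeless cubic graph containing a connected $3$-edge-colorable cubic graph as a spanning minor has a family of $6$ even subgraphs that together cover every edge exactly twice. -/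

import Mathlib

/-! Multigraphs (loops and parallel edges allowed) are Mathlib's `Graph α β`. -/

namespace Graph

open scoped Graph

universe u v u' v'

/-- The degree of a vertex of a multigraph; a loop counts twice. -/
noncomputable def degree {α : Type u} {β : Type v} (G : Graph α β) (x : α) : ℕ∞ :=
  {e | G.IsNonloopAt e x}.encard + 2 * {e | G.IsLoopAt e x}.encard

/-- Every vertex has degree `k`. -/
def IsRegular {α : Type u} {β : Type v} (G : Graph α β) (k : ℕ) : Prop :=
  ∀ x ∈ V(G), G.degree x = k

/-- A cubic graph is a `3`-regular (multi)graph. -/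
def IsCubic {α : Type u} {β : Type v} (G : Graph α β) : Prop :=
  G.IsRegular 3

/-- Two vertices joined by a walk (for vertices of `G`: they lie in the same component). -/
def Reachable {α : Type u} {β : Type v} (G : Graph α β) (x y : α) : Prop :=
  Relation.ReflTransGen G.Adj x y

/-- A connected graph: nonempty, and any two vertices are joined by a walk. -/
def IsConnected {α : Type u} {β : Type v} (G : Graph α β) : Prop :=
  V(G).Nonempty ∧ ∀ x ∈ V(G), ∀ y ∈ V(G), G.Reachable x y

/-- No edge is a bridge: the ends of an edge stay in one component when the edge is deleted. -/
def IsBridgeless {α : Type u} {β : Type v} (G : Graph α β) : Prop :=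
  ∀ e x y, G.IsLink e x y → (G.deleteEdges {e}).Reachable x y

/-- As a graph in itself, `C` is a circuit: finite, connected and `2`-regular
(so one vertex with a loop, or two vertices with two parallel edges, are circuits). -/
def IsCircuit {α : Type u} {β : Type v} (C : Graph α β) : Prop :=
  V(C).Finite ∧ C.IsConnected ∧ C.IsRegular 2

/-- `G` is cyclically `k`-edge-connected: after the deletion of fewer than `k` edges, there are
never two different components that both contain a circuit. -/
def IsCyclicallyEdgeConnected {α : Type u} {β : Type v} (G : Graph α β) (k : ℕ) : Prop :=
  ∀ S ⊆ E(G), S.encard < k → ∀ C D : Graph α β, C.IsCircuit → D.IsCircuit →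
    C ≤ G.deleteEdges S → D ≤ G.deleteEdges S →
    ∀ x ∈ V(C), ∀ y ∈ V(D), (G.deleteEdges S).Reachable x y

/-- Proper edge-colorability with `n` colors: `G` has no loops, and distinct edges with a common
end get distinct colors. -/
def IsEdgeColorable {α : Type u} {β : Type v} (G : Graph α β) (n : ℕ) : Prop :=
  G.Loopless ∧ ∃ c : β → Fin n, ∀ e f x, G.Inc e x → G.Inc f x → e ≠ f → c e ≠ c f

/-- Isomorphism of multigraphs. -/
def IsIsomorphic {α : Type u} {β : Type v} {α' : Type u'} {β' : Type v'}
    (H : Graph α β) (K : Graph α' β') : Prop :=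
  ∃ (f : V(H) ≃ V(K)) (g : E(H) ≃ E(K)), ∀ (e : E(H)) (x y : V(H)),
    H.IsLink e x y ↔ K.IsLink (g e) (f x) (f y)

/-- `K` arises from `H` by subdividing one edge once: an edge `e` with ends `x` and `y` is replaced
by a path of length two through a new vertex `w`, whose edges are called `e` (from `x` to `w`)
and `e'` (from `w` to `y`), where `e'` is a new edge. -/
def IsElementarySubdivision {α : Type u} {β : Type v} (H K : Graph α β) : Prop :=
  ∃ e e' x y w, H.IsLink e x y ∧ e' ∉ E(H) ∧ w ∉ V(H) ∧ V(K) = insert w V(H) ∧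
    ∀ f a b, K.IsLink f a b ↔
      (f ≠ e ∧ H.IsLink f a b) ∨ (f = e ∧ s(a, b) = s(x, w)) ∨ (f = e' ∧ s(a, b) = s(w, y))

/-- `K` is a subdivision of `H`: up to isomorphism, it arises from `H` by a finite (possibly empty)
sequence of edge subdivisions. -/
def IsSubdivision {α : Type u} {β : Type v} {α' : Type u'} {β' : Type v'}
    (H : Graph α' β') (K : Graph α β) : Prop :=
  ∃ H₀ : Graph α β, H.IsIsomorphic H₀ ∧ Relation.ReflTransGen IsElementarySubdivision H₀ K

/-- `H` is a spanning minor of `G`: some subdivision of `H` is a spanning subgraph of `G`. -/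
def IsSpanningMinor {α : Type u} {β : Type v} {α' : Type u'} {β' : Type v'}
    (H : Graph α' β') (G : Graph α β) : Prop :=
  ∃ K : Graph α β, H.IsSubdivision K ∧ K.IsSpanningSubgraph G

end Graph

/-! In a cubic graph, a nonempty vertex set left by at most one edge spans at least as many edges as
it has vertices, so it contains a circuit. Hence every cut of `G` has at least two edges
(`two_le_card_edgeCut`), which gives bridgelessness and, by Petersen's theorem
(`exists_perfectMatching`), a perfect matching M. Let F be the complementary 2-factor.

A cut that avoids F has circuits of F on both sides, hence at least four edges. Contracting F
therefore leaves a 4-edge-connected graph, and the Nash-Williams–Tutte theorem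
(`exists_disjoint_connects`, obtained from base packing in linear matroids) yields disjoint A and B
such that F ∪ A and F ∪ B are both connected and spanning. One may take A to be a nonempty subset of
M.

Since F ∪ B is connected, A can be completed to an even edge set h by edges of F ∪ B alone
(`Connects.exists_even_completion`). Put N = M ∩ h, which contains A, so that F ∪ N is connected.
Color N with 2, the edges of F in h with 1 and the other edges of F with 0. At an end of an edge of
N, parity of h puts exactly one of the two edges of F into h, so all three colors occur. At any
other vertex only the two edges of F remain, and parity gives them the same color
(`exists_coloring`). Suppressing the vertices of degree two thus leaves a properly 3-edge-colored
connected cubic graph (`IsColoredSubdivision.exists_cubic`). -/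

set_option linter.unusedSectionVars false

/-! ### Packing bases in linear matroids -/

section BasePacking

open Submodule Module

variable {K W ι κ : Type*} [Field K] [AddCommGroup W] [Module K W]

/-- The elements of the fundamental circuit of `e` in `A`, other than `e`, span `v e`. -/
theorem LinearIndepOn.mem_span_exchangeable {v : ι → W} {A : Set ι} (hA : LinearIndepOn K v A)
    {e : ι} (he : v e ∈ span K (v '' A)) :
    v e ∈ span K (v '' {f | f ∈ A ∧ v e ∉ span K (v '' (A \ {f}))}) := by
  classical
  obtain ⟨c, hc, hce⟩ := (Finsupp.mem_span_image_iff_linearCombination K).1 he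
  rw [Finsupp.linearCombination_apply, Finsupp.sum] at hce
  rw [← hce]
  refine Submodule.sum_mem _ fun f hf => Submodule.smul_mem _ _ (subset_span ⟨f, ⟨hc hf, ?_⟩, rfl⟩)
  -- The coefficient of `v f` is nonzero, so solving the expansion for `v f` would put it into the
  -- span of the rest of `A`.
  intro hmem
  have hcf : c f ≠ 0 := Finsupp.mem_support_iff.1 hf
  have hrest : ∑ a ∈ c.support.erase f, c a • v a ∈ span K (v '' (A \ {f})) := by
    refine Submodule.sum_mem _ fun a ha => Submodule.smul_mem _ _ (subset_span ⟨a, ⟨?_, ?_⟩, rfl⟩)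
    · exact hc (Finset.mem_of_mem_erase ha)
    · exact Finset.ne_of_mem_erase ha
  have hvf := Submodule.sub_mem _ hmem hrest
  rw [← Finset.add_sum_erase _ (fun a => c a • v a) hf, add_sub_cancel_right,
    Submodule.smul_mem_iff _ hcf] at hvf
  exact hA.notMem_span (hc hf) hvf

theorem LinearIndepOn.finrank_span_image {v : ι → W} {A : Finset ι}
    (hA : LinearIndepOn K v (A : Set ι)) : finrank K (span K (v '' (A : Set ι))) = A.card := by
  have := finrank_span_eq_card hA.linearIndependent
  rw [Set.image_eq_range]
  simpa using this

/-- A family of pairwise disjoint independent sets. -/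
structure IsIndepPacking (K : Type*) {W ι κ : Type*} [Field K] [AddCommGroup W] [Module K W]
    (v : ι → W) (T : κ → Finset ι) : Prop where
  disjoint : ∀ j k, j ≠ k → Disjoint (T j) (T k)
  indep : ∀ k, LinearIndepOn K v (T k : Set ι)

theorem IsIndepPacking.update [DecidableEq ι] [DecidableEq κ] {v : ι → W} {T : κ → Finset ι}
    (hT : IsIndepPacking K v T)
    {e : ι} (he : ∀ k, e ∉ T k) {k : κ} {A : Finset ι} (hA : A ⊆ insert e (T k))
    (hi : LinearIndepOn K v (A : Set ι)) : IsIndepPacking K v (Function.update T k A) := by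
  have key : ∀ j, j ≠ k → Disjoint A (T j) := fun j hj =>
    Finset.disjoint_of_subset_left hA
      (Finset.disjoint_insert_left.2 ⟨he j, hT.disjoint _ _ hj.symm⟩)
  constructor
  · intro i j hij
    by_cases hi : i = k
    · subst hi
      rw [Function.update_self, Function.update_of_ne hij.symm]
      exact key j hij.symm
    · rw [Function.update_of_ne hi]
      by_cases hj : j = k
      · subst hj
        rw [Function.update_self]
        exact (key i hi).symm
      · rw [Function.update_of_ne hj]
        exact hT.disjoint i j hij
  · intro j
    by_cases hj : j = k
    · subst hj
      rwa [Function.update_self]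
    · rw [Function.update_of_ne hj]
      exact hT.indep j

/-- The packings, with a distinguished uncovered element, that arise from `T₀` by exchanges. -/
inductive ExchangeReachable (K : Type*) {W ι κ : Type*} [Field K] [AddCommGroup W] [Module K W]
    [DecidableEq ι] [DecidableEq κ]
    (v : ι → W) (T₀ : κ → Finset ι) : (κ → Finset ι) → ι → Prop
  | start (e : ι) (h : ∀ k, e ∉ T₀ k) : ExchangeReachable K v T₀ T₀ e
  | step (T : κ → Finset ι) (e : ι) (k : κ) (f : ι) (h : ExchangeReachable K v T₀ T e)
      (hf : f ∈ T k) (hef : v e ∉ span K (v '' ((T k : Set ι) \ {f}))) :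
      ExchangeReachable K v T₀ (Function.update T k (insert e ((T k).erase f))) f

section Exchange

variable [DecidableEq ι] [DecidableEq κ] {v : ι → W} {T₀ T : κ → Finset ι} {e : ι}

theorem ExchangeReachable.isIndepPacking (hT₀ : IsIndepPacking K v T₀)
    (h : ExchangeReachable K v T₀ T e) :
    IsIndepPacking K v T ∧ (∀ k, e ∉ T k) ∧ ∀ k, (T k).card = (T₀ k).card := by
  induction h with
  | start e he => exact ⟨hT₀, he, fun _ => rfl⟩
  | step T e k f h hf hef ih =>
    obtain ⟨hT, he, hc⟩ := ih
    have hfe : f ≠ e := fun h => he k (h ▸ hf)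
    refine ⟨hT.update he (Finset.insert_subset_insert _ (Finset.erase_subset _ _)) ?_, ?_, ?_⟩
    · rw [Finset.coe_insert, Finset.coe_erase, linearIndepOn_insert]
      · exact ⟨(hT.indep k).mono Set.sdiff_subset, hef⟩
      · exact fun h => he k h.1
    · intro j
      by_cases hj : j = k
      · subst hj
        simp [hfe]
      · rw [Function.update_of_ne hj]
        exact fun h' => Finset.disjoint_left.1 (hT.disjoint j k hj) h' hf
    · intro j
      by_cases hj : j = k
      · subst hj
        rw [Function.update_self, Finset.card_insert_of_notMem, Finset.card_erase_of_mem hf, ← hc]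
        · have := Finset.card_pos.2 ⟨f, hf⟩
          omega
        · exact fun h => he j (Finset.mem_of_mem_erase h)
      · rw [Function.update_of_ne hj, hc]

/-- Exchanges preserve all cardinalities, so `T` is again a maximum packing; if `e` were independent
of `T k`, adding it would give a larger one. -/
theorem ExchangeReachable.mem_span [Fintype κ] (hT₀ : IsIndepPacking K v T₀)
    (hmax : ∀ T : κ → Finset ι, IsIndepPacking K v T → ∑ k, (T k).card ≤ ∑ k, (T₀ k).card)
    (h : ExchangeReachable K v T₀ T e) (k : κ) :
    v e ∈ span K (v '' (T k : Set ι)) := by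
  obtain ⟨hT, he, hc⟩ := h.isIndepPacking hT₀
  by_contra hne
  have hle := hmax _ (hT.update he (A := insert e (T k)) subset_rfl (by
    rw [Finset.coe_insert, linearIndepOn_insert (fun h => he k h)]
    exact ⟨hT.indep k, hne⟩))
  refine absurd hle (not_le.2 (Finset.sum_lt_sum (fun j _ => ?_) ⟨k, Finset.mem_univ _, ?_⟩))
  · by_cases hj : j = k
    · subst hj
      rw [Function.update_self, Finset.card_insert_of_notMem (he j), hc]
      omega
    · rw [Function.update_of_ne hj, hc]
  · rw [Function.update_self, Finset.card_insert_of_notMem (he k), hc]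
    omega

/-- The elements left uncovered by some packing reachable from `T₀`. -/
def exchangeSet (K : Type*) {W ι κ : Type*} [Field K] [AddCommGroup W] [Module K W]
    [DecidableEq ι] [DecidableEq κ] (v : ι → W) (T₀ : κ → Finset ι) : Set ι :=
  {e | ∃ T, ExchangeReachable K v T₀ T e}

theorem ExchangeReachable.mem_span_inter [Fintype κ] (hT₀ : IsIndepPacking K v T₀)
    (hmax : ∀ T : κ → Finset ι, IsIndepPacking K v T → ∑ k, (T k).card ≤ ∑ k, (T₀ k).card)
    (h : ExchangeReachable K v T₀ T e) (k : κ) :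
    v e ∈ span K (v '' (T k ∩ exchangeSet K v T₀)) := by
  refine span_mono (Set.image_mono ?_)
    (((h.isIndepPacking hT₀).1.indep k).mem_span_exchangeable (h.mem_span hT₀ hmax k))
  rintro f ⟨hf, hef⟩
  exact ⟨hf, _, .step T e k f h hf hef⟩

/-- The only new element of an exchanged member is `e`, and `v e` already lies in the span of the
old reachable part by `mem_span_inter`. So these spans never grow along exchanges. -/
theorem ExchangeReachable.span_inter_le [Fintype κ] (hT₀ : IsIndepPacking K v T₀)
    (hmax : ∀ T : κ → Finset ι, IsIndepPacking K v T → ∑ k, (T k).card ≤ ∑ k, (T₀ k).card)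
    (h : ExchangeReachable K v T₀ T e) (k : κ) :
    span K (v '' (T k ∩ exchangeSet K v T₀)) ≤ span K (v '' (T₀ k ∩ exchangeSet K v T₀)) := by
  induction h with
  | start e he => exact le_rfl
  | step T e j f h hf hef ih =>
    by_cases hj : k = j
    · subst hj
      refine span_le.2 ?_
      rintro _ ⟨g, ⟨hg, hgQ⟩, rfl⟩
      rw [Function.update_self] at hg
      apply ih
      rcases Finset.mem_insert.1 (Finset.mem_coe.1 hg) with rfl | hg
      · exact h.mem_span_inter hT₀ hmax k
      · exact subset_span ⟨g, ⟨Finset.mem_of_mem_erase hg, hgQ⟩, rfl⟩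
    · rwa [Function.update_of_ne hj]

theorem exchangeSet_image_subset [Fintype κ] (hT₀ : IsIndepPacking K v T₀)
    (hmax : ∀ T : κ → Finset ι, IsIndepPacking K v T → ∑ k, (T k).card ≤ ∑ k, (T₀ k).card)
    (k : κ) : v '' exchangeSet K v T₀ ⊆ span K (v '' (T₀ k ∩ exchangeSet K v T₀)) := by
  rintro _ ⟨e, ⟨T, hT⟩, rfl⟩
  exact hT.span_inter_le hT₀ hmax k (hT.mem_span_inter hT₀ hmax k)

end Exchange

/-- Edmonds' base packing theorem for linear matroids. -/
theorem exists_pairwise_disjoint_spanning [Fintype ι] [Fintype κ] [FiniteDimensional K W]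
    (v : ι → W)
    (h : ∀ U : Submodule K W, Fintype.card κ * finrank K (W ⧸ U) ≤ {i | v i ∉ U}.ncard) :
    ∃ T : κ → Finset ι, (∀ j k, j ≠ k → Disjoint (T j) (T k)) ∧
      ∀ k, span K (v '' (T k : Set ι)) = ⊤ := by
  classical
  obtain ⟨T, hT, hmax⟩ := Finset.exists_max_image
    (Finset.univ.filter fun T : κ → Finset ι => IsIndepPacking K v T)
    (fun T => ∑ k, (T k).card)
    ⟨fun _ => ∅, by simp only [Finset.mem_filter, Finset.mem_univ, true_and]; constructor <;> simp⟩
  simp only [Finset.mem_filter, Finset.mem_univ, true_and] at hT hmax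
  refine ⟨T, hT.disjoint, ?_⟩
  set Q := exchangeSet K v T
  set U := span K (v '' Q)
  have hUk : ∀ k, U ≤ span K (v '' (T k ∩ Q)) := fun k =>
    span_le.2 (exchangeSet_image_subset hT hmax k)
  -- The elements of `T k` that `v` maps into `U` are independent and, by `hUk`, span `U`.
  have hcard : ∀ k, ((T k).filter fun i => v i ∉ U).card + finrank K U = (T k).card := by
    intro k
    rw [← Finset.card_filter_add_card_filter_not (s := T k) (fun i => v i ∈ U), add_comm]
    congr 1
    have hli : LinearIndepOn K v (((T k).filter fun i => v i ∈ U : Finset ι) : Set ι) :=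
      (hT.indep k).mono (Finset.coe_subset.2 (Finset.filter_subset _ _))
    rw [← hli.finrank_span_image]
    suffices hspan : span K (v '' ((T k).filter fun i => v i ∈ U : Finset ι)) = U by rw [hspan]
    apply le_antisymm
    · refine span_le.2 ?_
      rintro _ ⟨i, hi, rfl⟩
      exact (Finset.mem_filter.1 (Finset.mem_coe.1 hi)).2
    · refine (hUk k).trans (span_mono (Set.image_mono ?_))
      rintro i ⟨hi, hQ⟩
      exact Finset.mem_coe.2 (Finset.mem_filter.2 ⟨hi, subset_span ⟨i, hQ, rfl⟩⟩)
  -- An element in no `T k` belongs to `Q` through the trivial exchange sequence, so everything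
  -- outside `U` is covered.
  have hcover : {i | v i ∉ U}.ncard ≤ ∑ k, ((T k).filter fun i => v i ∉ U).card := by
    rw [Set.ncard_eq_toFinset_card']
    refine (Finset.card_le_card ?_).trans Finset.card_biUnion_le
    intro i hi
    simp only [Set.mem_toFinset, Set.mem_ofPred_eq] at hi
    by_contra hne
    simp only [Finset.mem_biUnion, Finset.mem_univ, true_and, Finset.mem_filter, not_exists,
      not_and, not_not] at hne
    by_cases hk : ∃ k, i ∈ T k
    · obtain ⟨k, hk⟩ := hk
      exact hi (hne k hk)
    · push Not at hk
      exact hi (subset_span ⟨i, ⟨T, .start i hk⟩, rfl⟩)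
  have hle : ∀ k, (T k).card ≤ finrank K W := fun k =>
    (hT.indep k).finrank_span_image ▸ Submodule.finrank_le _
  have hU := finrank_quotient_add_finrank U
  -- The hypothesis for this `U` supplies the codimension part of the count and `hcard` the
  -- dimension part. As no `T k` exceeds `finrank K W`, every one is a basis.
  have hsum : ∑ _k : κ, finrank K W ≤ ∑ k, (T k).card := by
    have h1 := (h U).trans hcover
    have h2 : ∑ k, (T k).card = ∑ k, ((T k).filter fun i => v i ∉ U).card
        + Fintype.card κ * finrank K U := by
      simp_rw [← hcard, Finset.sum_add_distrib]
      simp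
    rw [h2, ← hU, Finset.sum_const, Finset.card_univ, smul_eq_mul, mul_add]
    omega
  intro k
  have := (Finset.sum_eq_sum_iff_of_le fun k _ => hle k).1
    (le_antisymm (Finset.sum_le_sum fun k _ => hle k) hsum) k (Finset.mem_univ k)
  exact Submodule.eq_top_of_finrank_eq ((hT.indep k).finrank_span_image.trans this)

end BasePacking

/-! ### Cuts, circuits and perfect matchings in cubic multigraphs -/

namespace EndMaps

variable {V E : Type*} [Fintype V] [Fintype E] [DecidableEq V] [DecidableEq E] (a b : E → V)

/-- The degree of `v` in the multigraph on `V` in which an edge `e ∈ D` has the ends `a e`, `b e`. -/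
def endDegree (D : Finset E) (v : V) : ℕ :=
  ∑ e ∈ D, ((if a e = v then 1 else 0) + (if b e = v then 1 else 0))

/-- The edges with exactly one end in `X`. -/
def edgeCut (X : Finset V) : Finset E :=
  Finset.univ.filter fun e => ¬(a e ∈ X ↔ b e ∈ X)

/-- A nonempty disjoint union of circuits. -/
def IsCircuitUnion (C : Finset E) : Prop :=
  C.Nonempty ∧ ∀ v, endDegree a b C v = 0 ∨ endDegree a b C v = 2

/-- An edge cut with circuits on both sides has at least `k` edges. -/
def CyclicCutsGe (k : ℕ) : Prop :=
  ∀ (X : Finset V) (C D : Finset E), IsCircuitUnion a b C → IsCircuitUnion a b D →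
    (∀ e ∈ C, a e ∈ X ∧ b e ∈ X) → (∀ e ∈ D, a e ∉ X ∧ b e ∉ X) → k ≤ (edgeCut a b X).card

variable {a b}

theorem mem_edgeCut {X : Finset V} {e : E} : e ∈ edgeCut a b X ↔ ¬(a e ∈ X ↔ b e ∈ X) := by
  simp [edgeCut]

theorem edgeCut_compl (X : Finset V) : edgeCut a b Xᶜ = edgeCut a b X := by
  ext e
  simp only [mem_edgeCut, Finset.mem_compl]
  tauto

theorem edgeCut_univ : edgeCut a b Finset.univ = ∅ := by
  ext e
  simp [mem_edgeCut]

theorem endDegree_mono {C D : Finset E} (h : C ⊆ D) (v : V) :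
    endDegree a b C v ≤ endDegree a b D v :=
  Finset.sum_le_sum_of_subset h

theorem sum_endDegree (X : Finset V) :
    ∑ v ∈ X, endDegree a b Finset.univ v =
      (edgeCut a b X).card + 2 * (Finset.univ.filter fun e => a e ∈ X ∧ b e ∈ X).card := by
  unfold endDegree edgeCut
  rw [Finset.sum_comm, Finset.card_filter, Finset.card_filter, Finset.mul_sum,
    ← Finset.sum_add_distrib]
  refine Finset.sum_congr rfl fun e _ => ?_
  rw [Finset.sum_add_distrib, Finset.sum_ite_eq, Finset.sum_ite_eq]
  by_cases h1 : a e ∈ X <;> by_cases h2 : b e ∈ X <;> simp [h1, h2]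

/-- A set of vertices of a cubic graph that is left by at most one edge contains a circuit. -/
theorem exists_isCircuitUnion (hcub : ∀ v, endDegree a b Finset.univ v = 3) {X : Finset V}
    (hX : X.Nonempty) (hcut : (edgeCut a b X).card ≤ 1) :
    ∃ C, IsCircuitUnion a b C ∧ ∀ e ∈ C, a e ∈ X ∧ b e ∈ X := by
  set EX := Finset.univ.filter fun e => a e ∈ X ∧ b e ∈ X with hEX
  -- Counting ends gives 3|X| ≤ 1 + 2|EX|, and |X| ≥ 1.
  have hcard : X.card ≤ EX.card := by
    have h := sum_endDegree (a := a) (b := b) X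
    rw [Finset.sum_congr rfl fun v _ => hcub v, Finset.sum_const, smul_eq_mul, ← hEX] at h
    have := hX.card_pos
    omega
  let L : (EX → ZMod 2) →ₗ[ZMod 2] (X → ZMod 2) :=
    { toFun := fun g v => ∑ e : EX, g e *
        ((if a e = v then 1 else 0) + (if b e = v then 1 else 0))
      map_add' := fun g h => by
        ext v
        simp [add_mul, Finset.sum_add_distrib]
      map_smul' := fun r g => by
        ext v
        simp [Finset.mul_sum, mul_assoc] }
  -- The mod 2 boundary map `L` lands in the hyperplane of sum zero, so it is not surjective; since
  -- its source is at least as large as its target, it has a nonzero kernel element. The support of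
  -- that element has even degrees at most 3.
  have hL : ∀ g, ∑ v, L g v = 0 := by
    intro g
    change ∑ v : X, ∑ e : EX, _ = 0
    rw [Finset.sum_comm]
    refine Finset.sum_eq_zero fun e _ => ?_
    rw [← Finset.mul_sum, Finset.sum_add_distrib]
    have he := (Finset.mem_filter.1 e.2).2
    have h1 : ∀ x ∈ X, ∑ v : X, (if x = (v : V) then (1 : ZMod 2) else 0) = 1 := by
      intro x hx
      rw [Finset.sum_eq_single_of_mem ⟨x, hx⟩ (Finset.mem_univ _)]
      · simp
      · intro v _ hv
        rw [if_neg]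
        rintro rfl
        exact hv rfl
    rw [h1 _ he.1, h1 _ he.2]
    have : (1 : ZMod 2) + 1 = 0 := by decide
    rw [this, mul_zero]
  have hinj : ¬ Function.Injective L := by
    intro hinj
    have h1 := LinearMap.finrank_le_finrank_of_injective hinj
    simp only [Module.finrank_fintype_fun_eq_card, Fintype.card_coe] at h1
    have hsurj := (LinearMap.injective_iff_surjective_of_finrank_eq_finrank (f := L) (by
      simp only [Module.finrank_fintype_fun_eq_card, Fintype.card_coe]; omega)).1 hinj
    obtain ⟨x, hx⟩ := hX
    obtain ⟨g, hg⟩ := hsurj (Pi.single ⟨x, hx⟩ 1)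
    have := hL g
    rw [hg, Finset.sum_pi_single'] at this
    simp at this
  rw [← LinearMap.ker_eq_bot, Submodule.eq_bot_iff] at hinj
  push Not at hinj
  obtain ⟨g, hg, hg0⟩ := hinj
  set C : Finset E := (Finset.univ.filter fun e : EX => g e = 1).map ⟨_, Subtype.val_injective⟩
    with hC
  have hz : ∀ z : ZMod 2, z ≠ 0 → z = 1 := by decide
  have hCX : ∀ e ∈ C, a e ∈ X ∧ b e ∈ X := by
    intro e he
    obtain ⟨e', -, rfl⟩ := Finset.mem_map.1 he
    exact (Finset.mem_filter.1 e'.2).2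
  refine ⟨C, ⟨?_, ?_⟩, hCX⟩
  · obtain ⟨e, he⟩ := Function.ne_iff.1 hg0
    exact ⟨e, Finset.mem_map.2 ⟨e, by simpa using hz _ he, rfl⟩⟩
  · intro v
    by_cases hv : v ∈ X
    · have h0 : ((endDegree a b C v : ℕ) : ZMod 2) = 0 := by
        have := congrFun hg ⟨v, hv⟩
        rw [show (0 : ZMod 2) = (0 : X → ZMod 2) ⟨v, hv⟩ from rfl, ← this]
        change _ = ∑ e : EX, _
        rw [endDegree, hC, Finset.sum_map, Finset.sum_filter]
        push_cast
        refine Finset.sum_congr rfl fun e _ => ?_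
        by_cases he : g e = 1
        · simp [he]
        · have : g e = 0 := by
            by_contra h
            exact he (hz _ h)
          simp [this]
      have h1 := (ZMod.natCast_eq_zero_iff_even).1 h0
      have h2 := endDegree_mono (a := a) (b := b) (Finset.subset_univ C) v
      rw [hcub] at h2
      obtain ⟨k, hk⟩ := h1
      omega
    · left
      refine Finset.sum_eq_zero fun e he => ?_
      have := hCX e he
      rw [if_neg (fun h : a e = v => hv (h ▸ this.1)), if_neg (fun h : b e = v => hv (h ▸ this.2)), add_zero]

theorem two_le_card_edgeCut (hcub : ∀ v, endDegree a b Finset.univ v = 3)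
    (hcyc : CyclicCutsGe a b 4) {X : Finset V} (hX : X.Nonempty) (hX' : X ≠ Finset.univ) :
    2 ≤ (edgeCut a b X).card := by
  by_contra hlt
  obtain ⟨C, hC, hCX⟩ := exists_isCircuitUnion hcub hX (by omega)
  obtain ⟨D, hD, hDX⟩ := exists_isCircuitUnion hcub (X := Xᶜ)
    (by rwa [Finset.nonempty_iff_ne_empty, Ne, Finset.compl_eq_empty_iff])
    (by rw [edgeCut_compl]; omega)
  have := hcyc X C D hC hD hCX (by simpa using hDX)
  omega

/-- In a cubic graph, an edge cut has the parity of the number of vertices on a side. -/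
theorem odd_card_edgeCut_iff (hcub : ∀ v, endDegree a b Finset.univ v = 3) (X : Finset V) :
    Odd (edgeCut a b X).card ↔ Odd X.card := by
  have h := sum_endDegree (a := a) (b := b) X
  rw [Finset.sum_congr rfl fun v _ => hcub v, Finset.sum_const, smul_eq_mul] at h
  rw [Nat.odd_iff, Nat.odd_iff]
  omega

/-- A loop uses two of the three ends at its vertex, leaving a cut of one edge. If there is no other
vertex, the empty cut contradicts parity. -/
theorem loopless_of_two_le_card_edgeCut (hcub : ∀ v, endDegree a b Finset.univ v = 3)
    (hconn : ∀ X : Finset V, X.Nonempty → X ≠ Finset.univ → 2 ≤ (edgeCut a b X).card) (e : E) :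
    a e ≠ b e := by
  intro h
  have h1 := sum_endDegree (a := a) (b := b) {a e}
  have h2 := odd_card_edgeCut_iff hcub {a e}
  have h3 := hconn {a e} (Finset.singleton_nonempty _)
  rw [Finset.sum_singleton, hcub] at h1
  have h4 : 0 < (Finset.univ.filter fun f => a f ∈ ({a e} : Finset V) ∧
      b f ∈ ({a e} : Finset V)).card :=
    Finset.card_pos.2 ⟨e, by simp [h]⟩
  by_cases hu : ({a e} : Finset V) = Finset.univ
  · rw [hu, edgeCut_univ, ← hu] at h2
    simp at h2
  · have := h3 hu
    omega

theorem endDegree_eq_card (hl : ∀ e, a e ≠ b e) (D : Finset E) (v : V) :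
    endDegree a b D v = (D.filter fun e => a e = v ∨ b e = v).card := by
  rw [Finset.card_filter]
  refine Finset.sum_congr rfl fun e _ => ?_
  have := hl e
  by_cases h1 : a e = v <;> by_cases h2 : b e = v <;> simp_all

/-- The inequality behind Petersen's theorem. -/
theorem card_odd_le (hcub : ∀ v, endDegree a b Finset.univ v = 3)
    (hconn : ∀ X : Finset V, X.Nonempty → X ≠ Finset.univ → 2 ≤ (edgeCut a b X).card)
    {κ : Type*} [Fintype κ] (X : κ → Finset V) (U : Finset V)
    (hodd : ∀ k, Odd (X k).card) (hXU : ∀ k, Disjoint (X k) U)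
    (hdisj : ∀ j k, j ≠ k → Disjoint (X j) (X k))
    (hcut : ∀ k, ∀ e ∈ edgeCut a b (X k), a e ∈ U ∨ b e ∈ U) : Fintype.card κ ≤ U.card := by
  -- These cuts are odd and not of size one. They are disjoint parts of the cut of `U`, which has at
  -- most 3|U| edges.
  have h3 : ∀ k, 3 ≤ (edgeCut a b (X k)).card := by
    intro k
    have h1 := (odd_card_edgeCut_iff hcub (X k)).2 (hodd k)
    have h2 := hconn (X k) (Finset.card_pos.1 (hodd k).pos) (by
      intro h
      rw [h, edgeCut_univ] at h1
      simp at h1)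
    obtain ⟨m, hm⟩ := h1
    omega
  have hsub : (Finset.univ.biUnion fun k => edgeCut a b (X k)) ⊆ edgeCut a b U := by
    intro e he
    obtain ⟨k, -, hk⟩ := Finset.mem_biUnion.1 he
    have hU := hcut k e hk
    rw [mem_edgeCut] at hk ⊢
    have h1 := fun h : a e ∈ X k => Finset.disjoint_left.1 (hXU k) h
    have h2 := fun h : b e ∈ X k => Finset.disjoint_left.1 (hXU k) h
    tauto
  have hpd : Set.PairwiseDisjoint (↑(Finset.univ : Finset κ)) fun k => edgeCut a b (X k) := by
    intro j _ k _ hjk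
    refine Finset.disjoint_left.2 fun e hj hk => ?_
    have hU := hcut k e hk
    rw [mem_edgeCut] at hk hj
    have h1 := fun h : a e ∈ X k => Finset.disjoint_left.1 (hXU k) h
    have h2 := fun h : b e ∈ X k => Finset.disjoint_left.1 (hXU k) h
    have h3 := fun h : a e ∈ X j => Finset.disjoint_left.1 (hXU j) h
    have h4 := fun h : b e ∈ X j => Finset.disjoint_left.1 (hXU j) h
    have h5 := fun h : a e ∈ X j => Finset.disjoint_left.1 (hdisj j k hjk) h
    have h6 := fun h : b e ∈ X j => Finset.disjoint_left.1 (hdisj j k hjk) h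
    tauto
  have hle := Finset.card_le_card hsub
  rw [Finset.card_biUnion hpd] at hle
  have h1 : ∑ _k : κ, 3 ≤ ∑ k, (edgeCut a b (X k)).card := Finset.sum_le_sum fun k _ => h3 k
  have h2 := sum_endDegree (a := a) (b := b) U
  rw [Finset.sum_congr rfl fun v _ => hcub v, Finset.sum_const, smul_eq_mul] at h2
  simp at h1
  omega

/-- Petersen's theorem: a bridgeless cubic graph has a perfect matching. -/
theorem exists_perfectMatching (hcub : ∀ v, endDegree a b Finset.univ v = 3)
    (hconn : ∀ X : Finset V, X.Nonempty → X ≠ Finset.univ → 2 ≤ (edgeCut a b X).card) :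
    ∃ M : Finset E, ∀ v, endDegree a b M v = 1 := by
  classical
  have hl := loopless_of_two_le_card_edgeCut hcub hconn
  -- Tutte's theorem is applied to the underlying simple graph, whose odd components after deletion
  -- of `u` serve as the sets of `card_odd_le`.
  let G : SimpleGraph V := SimpleGraph.fromRel fun u v => ∃ e, a e = u ∧ b e = v
  have hG : ∀ e, G.Adj (a e) (b e) := fun e => ⟨hl e, Or.inl ⟨e, rfl, rfl⟩⟩
  obtain ⟨M, hM⟩ : ∃ M : G.Subgraph, M.IsPerfectMatching := by
    rw [SimpleGraph.tutte]
    intro u hu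
    rw [SimpleGraph.IsTutteViolator] at hu
    set H := ((⊤ : G.Subgraph).deleteVerts u).coe with hH
    let X : H.oddComponents → Finset V := fun c =>
      (Subtype.val '' c.1.supp : Set V).toFinset
    have hmem : ∀ c v, v ∈ X c ↔ ∃ hv, H.connectedComponentMk ⟨v, hv⟩ = c.1 := by
      intro c v
      simp [X]
    have hnot : ∀ c v, v ∈ X c → v ∉ u := by
      intro c v hv
      obtain ⟨hv, -⟩ := (hmem c v).1 hv
      simpa using hv
    have hadj : ∀ c x y, G.Adj x y → y ∉ u → x ∈ X c → y ∈ X c := by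
      intro c x y hxy hy hx
      have hxu := hnot c x hx
      obtain ⟨hv, hvc⟩ := (hmem c x).1 hx
      refine (hmem c y).2 ⟨by simpa using hy, ?_⟩
      rw [← hvc]
      refine SimpleGraph.ConnectedComponent.sound (SimpleGraph.Adj.reachable ?_)
      simp [hH, hxu, hy, hxy.symm]
    have := card_odd_le hcub hconn X u.toFinset ?_ ?_ ?_ ?_
    · rw [Set.ncard_eq_toFinset_card', Set.ncard_eq_toFinset_card', Set.toFinset_card,
        Set.toFinset_card] at hu
      rw [Set.toFinset_card] at this
      omega
    · intro c
      have := c.2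
      simp only [Set.mem_ofPred_eq] at this
      rw [← Set.ncard_eq_toFinset_card', Set.ncard_image_of_injective _ Subtype.val_injective]
      exact this
    · intro c
      refine Finset.disjoint_left.2 fun v hv hvu => hnot c v hv (by simpa using hvu)
    · intro c d hcd
      refine Finset.disjoint_left.2 fun v hv hv' => hcd (Subtype.ext ?_)
      obtain ⟨_, h1⟩ := (hmem c v).1 hv
      obtain ⟨_, h2⟩ := (hmem d v).1 hv'
      rw [← h1, ← h2]
    · intro c e he
      rw [mem_edgeCut] at he
      rw [Set.mem_toFinset, Set.mem_toFinset]
      by_contra hne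
      push Not at hne
      exact he ⟨hadj c _ _ (hG e) hne.2, hadj c _ _ (hG e).symm hne.1⟩
  have hedge : ∀ s : Sym2 V, s ∈ M.edgeSet → ∃ e, s(a e, b e) = s := by
    intro s hs
    induction s with
    | h x y =>
      have hxy : G.Adj x y := M.adj_sub hs
      obtain ⟨-, ⟨e, rfl, rfl⟩ | ⟨e, rfl, rfl⟩⟩ := hxy
      · exact ⟨e, rfl⟩
      · exact ⟨e, Sym2.eq_swap⟩
  obtain _ | ⟨⟨v₀⟩⟩ := isEmpty_or_nonempty V
  · exact ⟨∅, fun v => isEmptyElim v⟩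
  -- `choose!` needs a default edge for pairs outside the matching.
  have : Nonempty E := by
    by_contra hE
    rw [not_nonempty_iff] at hE
    have := hcub v₀
    simp [endDegree] at this
  choose! φ hφ using hedge
  -- The second condition keeps just one edge of each parallel class.
  refine ⟨Finset.univ.filter fun e => s(a e, b e) ∈ M.edgeSet ∧ φ s(a e, b e) = e, fun v => ?_⟩
  rw [endDegree_eq_card hl, Finset.card_eq_one]
  obtain ⟨w, hw, hw'⟩ := SimpleGraph.Subgraph.isPerfectMatching_iff.1 hM v
  have hvw : s(v, w) ∈ M.edgeSet := hw
  refine ⟨φ s(v, w), ?_⟩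
  ext e
  simp only [Finset.mem_filter, Finset.mem_univ, true_and, Finset.mem_singleton]
  constructor
  · rintro ⟨⟨h1, h2⟩, rfl | rfl⟩
    · rw [← hw' _ h1, h2]
    · rw [Sym2.eq_swap] at h1
      rw [← hw' _ h1, Sym2.eq_swap, h2]
  · rintro rfl
    have := hφ _ hvw
    refine ⟨⟨by rwa [this], by rw [this]⟩, ?_⟩
    have hv : v ∈ s(a (φ s(v, w)), b (φ s(v, w))) := by
      rw [this]
      exact Sym2.mem_mk_left _ _
    rcases Sym2.mem_iff.1 hv with h | h
    · exact Or.inl h.symm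
    · exact Or.inr h.symm

end EndMaps

/-! ### Disjoint connectors, even completions and the coloring -/

namespace EndMaps

open Submodule Module

variable {V E : Type*} [Fintype V] [Fintype E] [DecidableEq V] [DecidableEq E] (a b : E → V)

/-- The edges in `S` connect all vertices. -/
def Connects (S : Finset E) : Prop :=
  ∀ X : Finset V, X.Nonempty → (∀ e ∈ S, a e ∈ X ↔ b e ∈ X) → X = Finset.univ

variable {a b}

theorem Connects.mono {S T : Finset E} (h : Connects a b S) (hST : S ⊆ T) : Connects a b T :=
  fun X hX hT => h X hX fun e he => hT e (hST he)

theorem connects_of_mem {S : Finset E} (x₀ : V)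
    (h : ∀ X : Finset V, x₀ ∈ X → (∀ e ∈ S, a e ∈ X ↔ b e ∈ X) → X = Finset.univ) :
    Connects a b S := by
  intro X hX hS
  by_cases hx : x₀ ∈ X
  · exact h X hx hS
  · have := h Xᶜ (Finset.mem_compl.2 hx) (fun e he => by
      rw [Finset.mem_compl, Finset.mem_compl, hS e he])
    rw [Finset.compl_eq_univ_iff] at this
    exact absurd this hX.ne_empty

/-- The Nash-Williams–Tutte theorem for two trees, relative to a set `F` of contracted edges, in
the `4`-edge-connected case. -/
theorem exists_disjoint_connects [Nonempty V] (F : Finset E)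
    (h : ∀ X : Finset V, X.Nonempty → X ≠ Finset.univ → (∀ e ∈ F, a e ∈ X ↔ b e ∈ X) →
      4 ≤ (edgeCut a b X).card) :
    ∃ A B : Finset E, Disjoint A B ∧ Connects a b (F ∪ A) ∧ Connects a b (F ∪ B) := by
  obtain ⟨x₀⟩ := ‹Nonempty V›
  let d : E → V → ℚ := fun e => Pi.single (a e) 1 - Pi.single (b e) 1
  -- Factoring out the vectors of `F` contracts these edges; factoring out the basis vector of `x₀`
  -- makes connecting edge sets correspond to spanning sets.
  let R : Submodule ℚ (V → ℚ) := span ℚ (insert (Pi.single x₀ 1) (d '' F))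
  have hrank : ∀ U : Submodule ℚ ((V → ℚ) ⧸ R), Fintype.card (Fin 2) *
      finrank ℚ (((V → ℚ) ⧸ R) ⧸ U) ≤ {e | R.mkQ (d e) ∉ U}.ncard := by
    intro U
    -- The fibres of `p` partition the vertices. Edges of `F` stay within fibres, the edges outside
    -- `U` are those between fibres, and the codimension of `U` is at most the number of fibres.
    let p : V → ((V → ℚ) ⧸ R) ⧸ U := fun x => U.mkQ (R.mkQ (Pi.single x 1))
    have hp₀ : p x₀ = 0 := by
      have : R.mkQ (Pi.single x₀ 1) = 0 := by
        rw [mkQ_apply, Quotient.mk_eq_zero]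
        exact subset_span (Set.mem_insert _ _)
      simp only [p]
      rw [this, map_zero]
    have hpe : ∀ e, R.mkQ (d e) ∉ U ↔ p (a e) ≠ p (b e) := by
      intro e
      rw [not_iff_comm, not_not, ← Quotient.mk_eq_zero, ← mkQ_apply, ← sub_eq_zero (a := p (a e))]
      simp only [p, d, map_sub]
    have hpF : ∀ e ∈ F, p (a e) = p (b e) := by
      intro e he
      by_contra hne
      refine (hpe e).2 hne ?_
      have : R.mkQ (d e) = 0 := by
        rw [mkQ_apply, Quotient.mk_eq_zero]
        exact subset_span (Set.mem_insert_of_mem _ ⟨e, he, rfl⟩)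
      rw [this]
      exact zero_mem _
    have hspan : span ℚ (Set.range p) = ⊤ := by
      have h1 : Set.range p = (U.mkQ ∘ₗ R.mkQ) '' Set.range fun x : V => Pi.single x (1 : ℚ) := by
        rw [← Set.range_comp]
        rfl
      have h2 : span ℚ (Set.range fun x : V => (Pi.single x 1 : V → ℚ)) = ⊤ := by
        convert (Pi.basisFun ℚ V).span_eq using 3
        ext x
        simp
      rw [h1, span_image, h2, Submodule.map_top, LinearMap.range_eq_top]
      exact (mkQ_surjective U).comp (mkQ_surjective R)
    classical
    set I := Finset.univ.image p with hI
    have hfin : finrank ℚ (((V → ℚ) ⧸ R) ⧸ U) ≤ I.card := by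
      rw [← finrank_top, ← hspan]
      have : Set.range p = (I : Set _) := by simp [hI]
      rw [this]
      exact finrank_span_finset_le_card I
    set cross := Finset.univ.filter fun e => p (a e) ≠ p (b e) with hcross
    have hset : {e | R.mkQ (d e) ∉ U}.ncard = cross.card := by
      rw [Set.ncard_eq_toFinset_card']
      congr 1
      ext e
      rw [Set.mem_toFinset, Set.mem_ofPred_eq, hpe]
      simp [hcross]
    rw [hset, Fintype.card_fin]
    -- With one fibre the cut bound says nothing, but then `p` vanishes because `p x₀ = 0`.
    by_cases hI1 : I.card ≤ 1
    · have h0 : ∀ x, p x = 0 := by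
        intro x
        rw [← hp₀]
        exact Finset.card_le_one.1 hI1 _ (Finset.mem_image_of_mem _ (Finset.mem_univ _)) _
          (Finset.mem_image_of_mem _ (Finset.mem_univ _))
      have : finrank ℚ (((V → ℚ) ⧸ R) ⧸ U) = 0 := by
        rw [← finrank_top, ← hspan]
        have : Set.range p ⊆ {0} := by
          rintro _ ⟨x, rfl⟩
          exact h0 x
        rw [show span ℚ (Set.range p) = ⊥ from span_eq_bot.2 fun x hx => this hx]
        exact finrank_bot _ _
      rw [this]
      omega
    · let cls : (((V → ℚ) ⧸ R) ⧸ U) → Finset V := fun z => Finset.univ.filter fun x => p x = z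
      have hcut : ∀ z e, e ∈ edgeCut a b (cls z) ↔ ¬(p (a e) = z ↔ p (b e) = z) := by
        intro z e
        simp [mem_edgeCut, cls]
      have h4 : ∀ z ∈ I, 4 ≤ (edgeCut a b (cls z)).card := by
        intro z hz
        obtain ⟨x, -, rfl⟩ := Finset.mem_image.1 hz
        refine h _ ⟨x, by simp [cls]⟩ ?_ ?_
        · intro hu
          apply hI1
          refine Finset.card_le_one.2 ?_
          have : ∀ z ∈ I, z = p x := by
            intro z hz
            obtain ⟨y, -, rfl⟩ := Finset.mem_image.1 hz
            have : y ∈ cls (p x) := hu ▸ Finset.mem_univ y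
            simpa [cls] using this
          intro z hz w hw
          rw [this z hz, this w hw]
        · intro e he
          simp [cls, hpF e he]
      -- Each crossing edge leaves at most two fibres, while each fibre is left by at least four
      -- edges; so there are at least twice as many crossing edges as fibres.
      have hsum : ∑ z ∈ I, (edgeCut a b (cls z)).card ≤ ∑ e ∈ cross, 2 := by
        have hc : ∀ z, (edgeCut a b (cls z)).card =
            ∑ e ∈ cross, if ¬(p (a e) = z ↔ p (b e) = z) then 1 else 0 := by
          intro z
          rw [← Finset.card_filter]
          congr 1
          ext e
          rw [hcut, Finset.mem_filter, hcross, Finset.mem_filter]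
          simp only [Finset.mem_univ, true_and]
          constructor
          · intro h
            exact ⟨fun h' => h (by rw [h']), h⟩
          · exact fun h => h.2
        simp_rw [hc]
        rw [Finset.sum_comm]
        refine Finset.sum_le_sum fun e _ => ?_
        rw [← Finset.card_filter]
        refine (Finset.card_le_card (t := {p (a e), p (b e)}) ?_).trans Finset.card_le_two
        intro z hz
        have := (Finset.mem_filter.1 hz).2
        rw [Finset.mem_insert, Finset.mem_singleton]
        by_contra hne
        push Not at hne
        exact this ⟨fun h => absurd h.symm hne.1, fun h => absurd h.symm hne.2⟩
      have h5 : ∑ z ∈ I, 4 ≤ ∑ z ∈ I, (edgeCut a b (cls z)).card := Finset.sum_le_sum h4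
      simp only [Finset.sum_const, smul_eq_mul] at h5 hsum
      omega
  obtain ⟨T, hT, hTs⟩ := exists_pairwise_disjoint_spanning (κ := Fin 2) (K := ℚ)
    (fun e => R.mkQ (d e)) hrank
  have hconn : ∀ k, Connects a b (F ∪ T k) := by
    intro k
    refine connects_of_mem x₀ fun X hx hX => ?_
    by_contra hne
    obtain ⟨y, hy⟩ : ∃ y, y ∉ X := by
      by_contra hall
      push Not at hall
      exact hne (Finset.eq_univ_iff_forall.2 hall)
    -- This functional kills `x₀` and every edge of `F ∪ T k`, hence everything by spanning, yet it
    -- is 1 at `y`.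
    let φ : (V → ℚ) →ₗ[ℚ] ℚ := ∑ x ∈ Xᶜ, LinearMap.proj x
    have hφ : ∀ x, φ (Pi.single x 1) = if x ∈ X then 0 else 1 := by
      intro x
      simp only [φ, LinearMap.coe_sum, Finset.sum_apply, LinearMap.proj_apply]
      rw [Finset.sum_pi_single']
      by_cases hx : x ∈ X <;> simp [hx]
    have hφe : ∀ e ∈ F ∪ T k, φ (d e) = 0 := by
      intro e he
      simp only [d, map_sub, hφ, hX e he, sub_self]
    have hR : R ≤ LinearMap.ker φ := by
      refine span_le.2 ?_
      rintro _ (rfl | ⟨e, he, rfl⟩)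
      · change φ _ = 0
        rw [hφ, if_pos hx]
      · exact hφe e (Finset.mem_union_left _ he)
    have htop : (⊤ : Submodule ℚ ((V → ℚ) ⧸ R)) ≤ LinearMap.ker (R.liftQ φ hR) := by
      rw [← hTs k]
      refine span_le.2 ?_
      rintro _ ⟨e, he, rfl⟩
      change R.liftQ φ hR (R.mkQ (d e)) = 0
      rw [mkQ_apply, liftQ_apply]
      exact hφe e (Finset.mem_union_right _ he)
    have h0 : R.liftQ φ hR (R.mkQ (Pi.single y 1)) = 0 := htop mem_top
    rw [mkQ_apply, liftQ_apply, hφ, if_neg hy] at h0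
    exact one_ne_zero h0
  exact ⟨T 0, T 1, hT 0 1 (by decide), hconn 0, hconn 1⟩

variable (a b) in
/-- The mod `2` boundary of a set of edges. -/
def boundary (g : E → ZMod 2) (v : V) : ZMod 2 :=
  ∑ e, g e * ((if a e = v then 1 else 0) + (if b e = v then 1 else 0))

theorem boundary_add (g h : E → ZMod 2) (v : V) :
    boundary a b (g + h) v = boundary a b g v + boundary a b h v := by
  simp [boundary, add_mul, Finset.sum_add_distrib]

theorem boundary_sum {κ : Type*} (s : Finset κ) (g : κ → E → ZMod 2) (v : V) :
    boundary a b (∑ k ∈ s, g k) v = ∑ k ∈ s, boundary a b (g k) v := by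
  simp only [boundary, Finset.sum_apply, Finset.sum_mul]
  exact Finset.sum_comm

theorem boundary_single (e : E) (v : V) : boundary a b (Pi.single e 1) v =
    (if a e = v then 1 else 0) + (if b e = v then 1 else 0) := by
  rw [boundary, Finset.sum_eq_single e]
  · simp
  · intro f _ hf
    rw [Pi.single_eq_of_ne hf, zero_mul]
  · simp

/-- A mod 2 version of a path: the admissible `y` include `x` and are closed under edges of `S`,
since adding such an edge to `g` moves the endpoint across it. -/
theorem Connects.exists_boundary_eq {S : Finset E} (hS : Connects a b S) (x y : V) :
    ∃ g : E → ZMod 2, (∀ e ∉ S, g e = 0) ∧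
      ∀ v, boundary a b g v = (if x = v then 1 else 0) + (if y = v then 1 else 0) := by
  classical
  have hz : ∀ z : ZMod 2, z + z = 0 := by decide
  let X : Finset V := Finset.univ.filter fun y => ∃ g : E → ZMod 2, (∀ e ∉ S, g e = 0) ∧
      ∀ v, boundary a b g v = (if x = v then 1 else 0) + (if y = v then 1 else 0)
  suffices hX : X = Finset.univ by
    have : y ∈ X := hX ▸ Finset.mem_univ y
    exact (Finset.mem_filter.1 this).2
  refine hS X ⟨x, ?_⟩ ?_
  · simp only [X, Finset.mem_filter, Finset.mem_univ, true_and]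
    refine ⟨0, fun _ _ => rfl, fun v => ?_⟩
    rw [hz]
    simp [boundary]
  · intro e he
    simp only [X, Finset.mem_filter, Finset.mem_univ, true_and]
    have hadd : ∀ g : E → ZMod 2, (∀ f ∉ S, g f = 0) →
        ∀ f ∉ S, (g + Pi.single e 1 : E → ZMod 2) f = 0 := by
      intro g hg f hf
      rw [Pi.add_apply, hg f hf, Pi.single_eq_of_ne (fun h => hf (by rwa [h])), add_zero]
    constructor
    · rintro ⟨g, hg, hgv⟩
      refine ⟨g + Pi.single e 1, hadd g hg, fun v => ?_⟩
      rw [boundary_add, boundary_single, hgv]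
      linear_combination hz (if a e = v then (1 : ZMod 2) else 0)
    · rintro ⟨g, hg, hgv⟩
      refine ⟨g + Pi.single e 1, hadd g hg, fun v => ?_⟩
      rw [boundary_add, boundary_single, hgv]
      linear_combination hz (if b e = v then (1 : ZMod 2) else 0)

/-- Every set of edges can be completed to an even set of edges by a set of edges in a given
connected spanning subgraph. -/
theorem Connects.exists_even_completion {S : Finset E} (hS : Connects a b S) (A : Finset E) :
    ∃ g : E → ZMod 2, (∀ e ∉ S, g e = 0) ∧
      ∀ v, boundary a b (g + ∑ e ∈ A, Pi.single e 1) v = 0 := by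
  have hz : ∀ z : ZMod 2, z + z = 0 := by decide
  choose g hg hgv using fun e => hS.exists_boundary_eq (a e) (b e)
  refine ⟨∑ e ∈ A, g e, fun f hf => ?_, fun v => ?_⟩
  · rw [Finset.sum_apply]
    exact Finset.sum_eq_zero fun e _ => hg e f hf
  · rw [boundary_add, boundary_sum, boundary_sum, ← Finset.sum_add_distrib]
    refine Finset.sum_eq_zero fun e _ => ?_
    rw [hgv, boundary_single, hz]

theorem isCircuitUnion_filter {F : Finset E} (hF : ∀ v, endDegree a b F v = 2) {X : Finset V}
    (hX : X.Nonempty) (hXF : ∀ e ∈ F, a e ∈ X ↔ b e ∈ X) :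
    IsCircuitUnion a b (F.filter fun e => a e ∈ X) := by
  have hdeg : ∀ v, endDegree a b (F.filter fun e => a e ∈ X) v = if v ∈ X then 2 else 0 := by
    intro v
    unfold endDegree
    rw [Finset.sum_filter]
    split_ifs with hv
    · rw [← hF v]
      refine Finset.sum_congr rfl fun e he => ?_
      have := hXF e he
      by_cases h1 : a e ∈ X
      · simp [h1]
      · have h2 : b e ∉ X := fun h => h1 (this.2 h)
        rw [if_neg h1, if_neg (fun h : a e = v => h1 (h ▸ hv)),
          if_neg (fun h : b e = v => h2 (h ▸ hv)), add_zero]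
    · refine Finset.sum_eq_zero fun e he => ?_
      have := hXF e he
      by_cases h1 : a e ∈ X
      · rw [if_pos h1, if_neg (fun h : a e = v => hv (h ▸ h1)),
          if_neg (fun h : b e = v => hv (h ▸ this.1 h1)), add_zero]
      · rw [if_neg h1]
  refine ⟨?_, fun v => ?_⟩
  · obtain ⟨v, hv⟩ := hX
    by_contra hne
    rw [Finset.not_nonempty_iff_eq_empty] at hne
    have := hdeg v
    rw [hne, if_pos hv] at this
    simp [endDegree] at this
  · rw [hdeg]
    split_ifs <;> simp

theorem exists_disjoint_connects_of_perfectMatching [Nonempty V] (hcyc : CyclicCutsGe a b 4)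
    {M : Finset E} (hM : ∀ v, endDegree a b M v = 1) (hF : ∀ v, endDegree a b Mᶜ v = 2) :
    ∃ A B : Finset E, Disjoint A B ∧ A ⊆ M ∧ A.Nonempty ∧
      Connects a b (Mᶜ ∪ A) ∧ Connects a b (Mᶜ ∪ B) := by
  obtain ⟨A, B, hAB, hA, hB⟩ := exists_disjoint_connects (a := a) (b := b) Mᶜ (by
    intro X hX hX' hXF
    refine hcyc X (Mᶜ.filter fun e => a e ∈ X) (Mᶜ.filter fun e => a e ∈ Xᶜ)
      (isCircuitUnion_filter hF hX hXF) (isCircuitUnion_filter hF ?_ ?_) ?_ ?_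
    · rwa [Finset.nonempty_iff_ne_empty, Ne, Finset.compl_eq_empty_iff]
    · intro e he
      rw [Finset.mem_compl, Finset.mem_compl, hXF e he]
    · intro e he
      obtain ⟨h1, h2⟩ := Finset.mem_filter.1 he
      exact ⟨h2, (hXF e h1).1 h2⟩
    · intro e he
      obtain ⟨h1, h2⟩ := Finset.mem_filter.1 he
      rw [Finset.mem_compl] at h2
      exact ⟨h2, fun h => h2 ((hXF e h1).2 h)⟩)
  have hA' : Mᶜ ∪ (A ∩ M) = Mᶜ ∪ A := by
    ext e
    simp only [Finset.mem_union, Finset.mem_compl, Finset.mem_inter]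
    tauto
  -- Nonemptiness of `A` later provides a vertex of degree three. If `A` avoids `M`, the 2-factor
  -- alone is connected, and `M` and `∅` serve instead.
  by_cases hne : (A ∩ M).Nonempty
  · exact ⟨A ∩ M, B, Finset.disjoint_of_subset_left Finset.inter_subset_left hAB,
      Finset.inter_subset_right, hne, hA' ▸ hA, hB⟩
  · rw [Finset.not_nonempty_iff_eq_empty] at hne
    rw [← hA', hne] at hA
    refine ⟨M, ∅, Finset.disjoint_empty_right _, subset_rfl, ?_,
      hA.mono (Finset.union_subset_union_right (Finset.empty_subset _)), hA⟩
    obtain ⟨v⟩ := ‹Nonempty V›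
    by_contra hne
    rw [Finset.not_nonempty_iff_eq_empty] at hne
    have := hM v
    rw [hne] at this
    simp [endDegree] at this

theorem boundary_eq_sum (hl : ∀ e, a e ≠ b e) (g : E → ZMod 2) (v : V) :
    boundary a b g v = ∑ e ∈ Finset.univ.filter fun e => a e = v ∨ b e = v, g e := by
  rw [Finset.sum_filter]
  refine Finset.sum_congr rfl fun e _ => ?_
  have := hl e
  by_cases h1 : a e = v <;> by_cases h2 : b e = v <;> simp_all

/-- A connected spanning subgraph with edge set `S` and all degrees `2` or `3`, not all `2`, with
a `3`-coloring of the edges that is proper at the vertices of degree `3` and constant at the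
vertices of degree `2`. -/
theorem exists_coloring [Nonempty V] (hcub : ∀ v, endDegree a b Finset.univ v = 3)
    (hcyc : CyclicCutsGe a b 4) :
    ∃ (S : Finset E) (c : E → Fin 3), Connects a b S ∧
      (∀ v, (∃ e : Fin 3 → E, (∀ i, c (e i) = i) ∧
          ∀ f, (f ∈ S ∧ (a f = v ∨ b f = v)) ↔ ∃ i, f = e i) ∨
        ∃ e f, e ≠ f ∧ c e = c f ∧ ∀ g, (g ∈ S ∧ (a g = v ∨ b g = v)) ↔ g = e ∨ g = f) ∧
      ∃ v, ∃ e : Fin 3 → E, (∀ i, c (e i) = i) ∧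
          ∀ f, (f ∈ S ∧ (a f = v ∨ b f = v)) ↔ ∃ i, f = e i := by
  have hz : ∀ z : ZMod 2, z = 0 ∨ z = 1 := by decide
  have hconn : ∀ X : Finset V, X.Nonempty → X ≠ Finset.univ → 2 ≤ (edgeCut a b X).card :=
    fun X hX hX' => two_le_card_edgeCut hcub hcyc hX hX'
  have hl := loopless_of_two_le_card_edgeCut hcub hconn
  obtain ⟨M, hM⟩ := exists_perfectMatching hcub hconn
  have hF : ∀ v, endDegree a b Mᶜ v = 2 := by
    intro v
    have : endDegree a b M v + endDegree a b Mᶜ v = endDegree a b Finset.univ v :=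
      Finset.sum_add_sum_compl _ _
    rw [hM, hcub] at this
    omega
  obtain ⟨A, B, hAB, hAM, hA₀, hA, hB⟩ := exists_disjoint_connects_of_perfectMatching hcyc hM hF
  obtain ⟨g, hg, hgv⟩ := hB.exists_even_completion A
  set h : E → ZMod 2 := g + ∑ e ∈ A, Pi.single e 1 with hh
  -- The completion `g` lives on `Mᶜ ∪ B`, which is disjoint from `A`, so it cannot cancel an edge
  -- of `A`.
  have hAh : ∀ e ∈ A, h e = 1 := by
    intro e he
    have h1 : g e = 0 := by
      apply hg
      rw [Finset.mem_union, Finset.mem_compl]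
      rintro (h1 | h1)
      · exact h1 (hAM he)
      · exact Finset.disjoint_left.1 hAB he h1
    rw [hh, Pi.add_apply, h1, Finset.sum_apply, Finset.sum_pi_single, if_pos he, zero_add]
  set N := M.filter fun e => h e = 1 with hN
  set c : E → Fin 3 := fun e => if e ∈ M then 2 else if h e = 1 then 1 else 0 with hc
  have hlocal : ∀ v, ∃ m f₁ f₂, m ∈ M ∧ f₁ ∉ M ∧ f₂ ∉ M ∧ f₁ ≠ f₂ ∧ h m + h f₁ + h f₂ = 0 ∧
      ∀ e, (a e = v ∨ b e = v) ↔ e = m ∨ e = f₁ ∨ e = f₂ := by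
    intro v
    obtain ⟨m, hm⟩ := Finset.card_eq_one.1 ((endDegree_eq_card hl M v).symm.trans (hM v))
    obtain ⟨f₁, f₂, hne, hf⟩ := Finset.card_eq_two.1 ((endDegree_eq_card hl Mᶜ v).symm.trans (hF v))
    have hm' : ∀ e, (e ∈ M ∧ (a e = v ∨ b e = v)) ↔ e = m := fun e => by
      simpa using Finset.ext_iff.1 hm e
    have hf' : ∀ e, (e ∉ M ∧ (a e = v ∨ b e = v)) ↔ e = f₁ ∨ e = f₂ := fun e => by
      simpa using Finset.ext_iff.1 hf e
    have hmM := ((hm' m).2 rfl).1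
    have hf₁ := ((hf' f₁).2 (Or.inl rfl)).1
    have hf₂ := ((hf' f₂).2 (Or.inr rfl)).1
    have hall : ∀ e, (a e = v ∨ b e = v) ↔ e = m ∨ e = f₁ ∨ e = f₂ := fun e => by
      rw [← hm', ← hf']
      tauto
    refine ⟨m, f₁, f₂, hmM, hf₁, hf₂, hne, ?_, hall⟩
    have hsum := hgv v
    rw [boundary_eq_sum hl, show (Finset.univ.filter fun e => a e = v ∨ b e = v) = {m, f₁, f₂} by
      ext e; simp [hall], Finset.sum_insert, Finset.sum_pair hne, ← add_assoc] at hsum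
    · exact hsum
    · rw [Finset.mem_insert, Finset.mem_singleton]
      rintro (rfl | rfl) <;> contradiction
  have hbranch : ∀ v m, m ∈ N → (a m = v ∨ b m = v) → ∃ e : Fin 3 → E, (∀ i, c (e i) = i) ∧
      ∀ f, (f ∈ Mᶜ ∪ N ∧ (a f = v ∨ b f = v)) ↔ ∃ i, f = e i := by
    intro v m hmN hmv
    obtain ⟨hmM, hm1⟩ := Finset.mem_filter.1 hmN
    obtain ⟨m', f₁, f₂, hmM', hf₁, hf₂, hne, hsum, hall⟩ := hlocal v
    obtain rfl : m = m' := by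
      rcases (hall m).1 hmv with rfl | rfl | rfl
      · rfl
      all_goals contradiction
    have key : ∀ f₁ f₂, f₁ ∉ M → f₂ ∉ M → h f₁ = 0 → h f₂ = 1 →
        (∀ e, (a e = v ∨ b e = v) ↔ e = m ∨ e = f₁ ∨ e = f₂) → ∃ e : Fin 3 → E,
        (∀ i, c (e i) = i) ∧ ∀ f, (f ∈ Mᶜ ∪ N ∧ (a f = v ∨ b f = v)) ↔ ∃ i, f = e i := by
      intro f₁ f₂ hf₁ hf₂ h1 h2 hall
      refine ⟨![f₁, f₂, m], ?_, ?_⟩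
      · intro i
        fin_cases i <;> simp [hc, hf₁, hf₂, h1, h2, hmM]
      · intro f
        rw [hall, Fin.exists_fin_succ, Fin.exists_fin_succ, Fin.exists_fin_one]
        simp only [Finset.mem_union, Finset.mem_compl]
        change _ ↔ f = f₁ ∨ f = f₂ ∨ f = m
        constructor
        · tauto
        · rintro (rfl | rfl | rfl) <;> simp [hf₁, hf₂, hmN]
    -- With `h m = 1`, evenness at `v` puts exactly one of `f₁`, `f₂` into `h`; that one gets color
    -- 1.
    rcases hz (h f₁) with h1 | h1
    · refine key f₁ f₂ hf₁ hf₂ h1 ?_ hall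
      rw [hm1, h1] at hsum
      revert hsum
      generalize h f₂ = z
      revert z
      decide
    · refine key f₂ f₁ hf₂ hf₁ ?_ h1 (fun e => (hall e).trans (by tauto))
      rw [hm1, h1] at hsum
      revert hsum
      generalize h f₂ = z
      revert z
      decide
  refine ⟨Mᶜ ∪ N, c, hA.mono (Finset.union_subset_union_right fun e he =>
    Finset.mem_filter.2 ⟨hAM he, hAh e he⟩), fun v => ?_, ?_⟩
  · obtain ⟨m, f₁, f₂, hmM, hf₁, hf₂, hne, hsum, hall⟩ := hlocal v
    by_cases hm1 : h m = 1
    · exact Or.inl (hbranch v m (Finset.mem_filter.2 ⟨hmM, hm1⟩) ((hall m).2 (Or.inl rfl)))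
    · right
      refine ⟨f₁, f₂, hne, ?_, fun f => ?_⟩
      · have hm0 := (hz (h m)).resolve_right hm1
        have : h f₁ = h f₂ := by
          rw [hm0] at hsum
          revert hsum
          generalize h f₁ = z
          generalize h f₂ = w
          revert z w
          decide
        simp [hc, hf₁, hf₂, this]
      · rw [hall]
        simp only [Finset.mem_union, Finset.mem_compl, hN, Finset.mem_filter]
        constructor
        · rintro ⟨h1, rfl | h2⟩
          · exact absurd h1 (by tauto)
          · exact h2
        · rintro (rfl | rfl) <;> simp [hf₁, hf₂]
  · obtain ⟨m, hm⟩ := hA₀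
    exact ⟨a m, hbranch _ m (Finset.mem_filter.2 ⟨hAM hm, hAh m hm⟩) (Or.inl rfl)⟩

end EndMaps

/-! ### Suppressing vertices of degree two -/

namespace Graph

open scoped Graph

variable {α β : Type*}

/-- A vertex of degree three whose edges have the three different colors. -/
def IsBranchVertex (K : Graph α β) (c : β → Fin 3) (v : α) : Prop :=
  ∃ e : Fin 3 → β, (∀ i, c (e i) = i) ∧ ∀ f, K.Inc f v ↔ ∃ i, f = e i

/-- A vertex of degree two whose edges have the same color. -/
def IsThreadVertex (K : Graph α β) (c : β → Fin 3) (v : α) : Prop :=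
  ∃ e f, e ≠ f ∧ c e = c f ∧ ∀ g, K.Inc g v ↔ g = e ∨ g = f

/-- A connected loopless graph with all degrees `2` or `3`, not all `2`, and an edge coloring that
becomes a proper `3`-coloring when the vertices of degree `2` are suppressed. -/
structure IsColoredSubdivision (K : Graph α β) (c : β → Fin 3) : Prop where
  loopless : K.Loopless
  connected : ∀ X ⊆ V(K), X.Nonempty → (∀ e x y, K.IsLink e x y → x ∈ X → y ∈ X) → X = V(K)
  branch_or_thread : ∀ v ∈ V(K), K.IsBranchVertex c v ∨ K.IsThreadVertex c v
  exists_branch : ∃ v ∈ V(K), K.IsBranchVertex c v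

theorem IsBranchVertex.eq_of_color_eq {K : Graph α β} {c : β → Fin 3} {v : α}
    (h : K.IsBranchVertex c v) {e f : β} (he : K.Inc e v) (hf : K.Inc f v) (hc : c e = c f) :
    e = f := by
  obtain ⟨g, hg, hinc⟩ := h
  obtain ⟨i, rfl⟩ := (hinc e).1 he
  obtain ⟨j, rfl⟩ := (hinc f).1 hf
  rw [hg, hg] at hc
  rw [hc]

/-- The graph in which a vertex `w` of degree two, with neighbors `x` and `y` along the edges `e`
and `e'`, is suppressed. -/
def suppress (K : Graph α β) (e e' : β) (x y w : α) (hx : x ∈ V(K) \ {w}) (hy : y ∈ V(K) \ {w})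
    (hw : ∀ g, K.Inc g w ↔ g = e ∨ g = e') : Graph α β where
  vertexSet := V(K) \ {w}
  IsLink f u v := (f = e ∧ ((u = x ∧ v = y) ∨ (u = y ∧ v = x))) ∨
    (f ≠ e ∧ f ≠ e' ∧ K.IsLink f u v)
  isLink_symm f _ := ⟨by
    rintro u v (⟨rfl, h | h⟩ | ⟨h1, h2, h⟩)
    · exact Or.inl ⟨rfl, Or.inr ⟨h.2, h.1⟩⟩
    · exact Or.inl ⟨rfl, Or.inl ⟨h.2, h.1⟩⟩
    · exact Or.inr ⟨h1, h2, h.symm⟩⟩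
  eq_or_eq_of_isLink_of_isLink := by
    rintro f u v u' v' (⟨rfl, h⟩ | ⟨h1, h2, h⟩) (⟨h3, h'⟩ | ⟨h3, h4, h'⟩)
    · rcases h with ⟨rfl, rfl⟩ | ⟨rfl, rfl⟩ <;> rcases h' with ⟨rfl, rfl⟩ | ⟨rfl, rfl⟩ <;> simp
    · exact absurd rfl h3
    · exact absurd h3 h1
    · exact h.left_eq_or_eq h'
  left_mem_of_isLink := by
    rintro f u v (⟨rfl, ⟨rfl, rfl⟩ | ⟨rfl, rfl⟩⟩ | ⟨h1, h2, h⟩)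
    · exact hx
    · exact hy
    · refine ⟨h.left_mem, ?_⟩
      rintro rfl
      exact ((hw f).1 h.inc_left).elim h1 h2

/-- The two edges at `w` have the same color, so merging them changes no color at any other vertex.
A branch vertex elsewhere prevents the merged edge from being a loop. -/
theorem IsColoredSubdivision.exists_suppress {K : Graph α β} {c : β → Fin 3}
    (hK : K.IsColoredSubdivision c) {w : α} (hw : w ∈ V(K)) (hwt : K.IsThreadVertex c w) :
    ∃ H : Graph α β, H.IsColoredSubdivision c ∧ V(H) = V(K) \ {w} ∧
      H.IsElementarySubdivision K := by
  classical
  have := hK.loopless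
  obtain ⟨e, e', hne, hcol, hinc⟩ := hwt
  obtain ⟨x, hx⟩ : ∃ x, K.IsLink e w x := (hinc e).2 (Or.inl rfl)
  obtain ⟨y, hy⟩ : ∃ y, K.IsLink e' w y := (hinc e').2 (Or.inr rfl)
  have hxw : x ≠ w := hx.ne.symm
  have hyw : y ≠ w := hy.ne.symm
  have hnb : ∀ v, K.Inc e v → K.Inc e' v → ¬ K.IsBranchVertex c v := fun v h1 h2 h =>
    hne (h.eq_of_color_eq h1 h2 hcol)
  -- If both edges at `w` ended in `x`, their equal colors would make `x` a thread vertex too. Then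
  -- `{w, x}` would be closed, hence the whole graph, with no branch vertex in it.
  have hxy : x ≠ y := by
    rintro rfl
    obtain ⟨f, f', hff, -, hincf⟩ := (hK.branch_or_thread x hx.right_mem).resolve_left
      (hnb x hx.inc_right hy.inc_right)
    have hxe : ∀ g, K.Inc g x ↔ g = e ∨ g = e' := by
      intro g
      have h1 := (hincf e).1 hx.inc_right
      have h2 := (hincf e').1 hy.inc_right
      rw [hincf]
      rcases h1 with rfl | rfl <;> rcases h2 with rfl | rfl <;> tauto
    have hV := hK.connected {w, x} (by
      rintro v (rfl | rfl)
      · exact hw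
      · exact hx.right_mem) ⟨w, Or.inl rfl⟩ (by
      intro g u v hg hu
      have hg' : g = e ∨ g = e' := by
        rcases hu with rfl | rfl
        · exact (hinc g).1 hg.inc_left
        · exact (hxe g).1 hg.inc_left
      rcases hg' with rfl | rfl
      · exact hg.inc_right.eq_or_eq_of_isLink hx
      · exact hg.inc_right.eq_or_eq_of_isLink hy)
    obtain ⟨v, hv, hvb⟩ := hK.exists_branch
    rw [← hV] at hv
    rcases hv with rfl | rfl
    · exact hnb _ hx.inc_left hy.inc_left hvb
    · exact hnb _ hx.inc_right hy.inc_right hvb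
  set H := K.suppress e e' x y w ⟨hx.right_mem, hxw⟩ ⟨hy.right_mem, hyw⟩ hinc with hH
  have hlink : ∀ f u v, H.IsLink f u v ↔ (f = e ∧ ((u = x ∧ v = y) ∨ (u = y ∧ v = x))) ∨
    (f ≠ e ∧ f ≠ e' ∧ K.IsLink f u v) := fun f u v => Iff.rfl
  have hHV : V(H) = V(K) \ {w} := rfl
  -- The merged edge keeps the name `e`; `φ` sends edges of `K` to edges of `H` and preserves
  -- colors.
  let φ : β → β := fun g => if g = e' then e else g
  have hφc : ∀ g, c (φ g) = c g := by
    intro g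
    by_cases hg : g = e' <;> simp [φ, hg, hcol]
  have hincH : ∀ v, v ≠ w → ∀ f, H.Inc f v ↔ ∃ g, K.Inc g v ∧ φ g = f := by
    intro v hv f
    constructor
    · rintro ⟨u, (⟨rfl, ⟨rfl, rfl⟩ | ⟨rfl, rfl⟩⟩ | ⟨h1, h2, h⟩)⟩
      · exact ⟨_, hx.inc_right, if_neg hne⟩
      · exact ⟨_, hy.inc_right, if_pos rfl⟩
      · exact ⟨_, h.inc_left, if_neg h2⟩
    · rintro ⟨g, ⟨u, hg⟩, rfl⟩
      by_cases hg' : g = e'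
      · subst hg'
        obtain rfl := (hg.inc_left.eq_or_eq_of_isLink hy).resolve_left hv
        exact ⟨x, Or.inl ⟨if_pos rfl, Or.inr ⟨rfl, rfl⟩⟩⟩
      · by_cases hge : g = e
        · subst hge
          obtain rfl := (hg.inc_left.eq_or_eq_of_isLink hx).resolve_left hv
          exact ⟨y, Or.inl ⟨if_neg hne, Or.inl ⟨rfl, rfl⟩⟩⟩
        · refine ⟨u, Or.inr ?_⟩
          rw [show φ g = g from if_neg hg']
          exact ⟨hge, hg', hg⟩
  have hbranch : ∀ v, v ≠ w → K.IsBranchVertex c v → H.IsBranchVertex c v := by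
    rintro v hv ⟨g, hg, hgi⟩
    refine ⟨fun i => φ (g i), fun i => by rw [hφc, hg], fun f => ?_⟩
    rw [hincH v hv]
    constructor
    · rintro ⟨_, h1, rfl⟩
      obtain ⟨i, rfl⟩ := (hgi _).1 h1
      exact ⟨i, rfl⟩
    · rintro ⟨i, rfl⟩
      exact ⟨g i, (hgi _).2 ⟨i, rfl⟩, rfl⟩
  have hthread : ∀ v, v ≠ w → K.IsThreadVertex c v → H.IsThreadVertex c v := by
    rintro v hv ⟨g, g', hgg, hgc, hgi⟩
    have hnot : ¬(K.Inc e v ∧ K.Inc e' v) := by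
      rintro ⟨h1, h2⟩
      exact hxy (((h1.eq_or_eq_of_isLink hx).resolve_left hv).symm.trans
        ((h2.eq_or_eq_of_isLink hy).resolve_left hv))
    refine ⟨φ g, φ g', ?_, by rw [hφc, hφc, hgc], fun f => ?_⟩
    · intro h
      simp only [φ] at h
      split_ifs at h with h1 h2 h2
      · exact hgg (h1.trans h2.symm)
      · exact hnot ⟨h ▸ (hgi _).2 (Or.inr rfl), h1 ▸ (hgi _).2 (Or.inl rfl)⟩
      · exact hnot ⟨h ▸ (hgi _).2 (Or.inl rfl), h2 ▸ (hgi _).2 (Or.inr rfl)⟩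
      · exact hgg h
    · rw [hincH v hv]
      constructor
      · rintro ⟨_, h1, rfl⟩
        rcases (hgi _).1 h1 with rfl | rfl <;> simp
      · rintro (rfl | rfl)
        · exact ⟨_, (hgi _).2 (Or.inl rfl), rfl⟩
        · exact ⟨_, (hgi _).2 (Or.inr rfl), rfl⟩
  refine ⟨H, ⟨⟨?_⟩, ?_, ?_, ?_⟩, hHV, e, e', x, y, w, ?_, ?_, ?_, ?_, ?_⟩
  · rintro f v (⟨-, ⟨h1, h2⟩ | ⟨h1, h2⟩⟩ | ⟨h1, h2, h⟩)
    · exact hxy (h1.symm.trans h2)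
    · exact hxy (h2.symm.trans h1)
    · exact K.not_isLoopAt f v h
  · intro X hX hXne hcl
    have hwX : w ∉ X := fun h => (hX h).2 rfl
    have hcl' : ∀ f u v, f ≠ e → f ≠ e' → K.IsLink f u v → u ∈ X → v ∈ X :=
      fun f u v h1 h2 h => hcl f u v (Or.inr ⟨h1, h2, h⟩)
    have hxyX : x ∈ X ↔ y ∈ X := ⟨hcl e x y (Or.inl ⟨rfl, Or.inl ⟨rfl, rfl⟩⟩),
      hcl e y x (Or.inl ⟨rfl, Or.inr ⟨rfl, rfl⟩⟩)⟩
    -- A closed set of `H` contains both or neither of `x`, `y`; with `w` added in the first case,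
    -- it is closed in `K`.
    by_cases hxX : x ∈ X
    · have hyX := hxyX.1 hxX
      have := hK.connected (insert w X) (Set.insert_subset hw (hX.trans Set.sdiff_subset))
        (Set.insert_nonempty _ _) (by
        intro f u v hf hu
        by_cases hfe : f = e ∨ f = e'
        · rcases hfe with rfl | rfl
          · rcases hf.inc_right.eq_or_eq_of_isLink hx with rfl | rfl
            · exact Or.inl rfl
            · exact Or.inr hxX
          · rcases hf.inc_right.eq_or_eq_of_isLink hy with rfl | rfl
            · exact Or.inl rfl
            · exact Or.inr hyX
        · have hu' : u ∈ X := hu.resolve_left (by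
            rintro rfl
            exact hfe ((hinc f).1 hf.inc_left))
          push Not at hfe
          exact Or.inr (hcl' f u v hfe.1 hfe.2 hf hu'))
      rw [hHV, ← this, Set.insert_sdiff_of_mem _ (Set.mem_singleton w),
        Set.sdiff_singleton_eq_self hwX]
    · have hyX := fun h => hxX (hxyX.2 h)
      have := hK.connected X (hX.trans Set.sdiff_subset) hXne (by
        intro f u v hf hu
        refine hcl' f u v ?_ ?_ hf hu
        · rintro rfl
          rcases hf.inc_left.eq_or_eq_of_isLink hx with rfl | rfl
          · exact hwX hu
          · exact hxX hu
        · rintro rfl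
          rcases hf.inc_left.eq_or_eq_of_isLink hy with rfl | rfl
          · exact hwX hu
          · exact hyX hu)
      exact absurd (this ▸ hw) hwX
  · rintro v ⟨hv, hvw⟩
    exact (hK.branch_or_thread v hv).imp (hbranch v hvw) (hthread v hvw)
  · obtain ⟨v, hv, hvb⟩ := hK.exists_branch
    have hvw : v ≠ w := by
      rintro rfl
      exact hnb _ hx.inc_left hy.inc_left hvb
    exact ⟨v, ⟨hv, hvw⟩, hbranch v hvw hvb⟩
  · exact Or.inl ⟨rfl, Or.inl ⟨rfl, rfl⟩⟩
  · intro h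
    obtain ⟨u, v, ⟨h, -⟩ | ⟨-, h, -⟩⟩ := exists_isLink_of_mem_edgeSet h
    · exact hne h.symm
    · exact h rfl
  · exact fun h => h.2 rfl
  · rw [hHV, Set.insert_sdiff_singleton, Set.insert_eq_of_mem hw]
  · intro f u v
    rw [hlink]
    by_cases hfe : f = e
    · subst hfe
      rw [hx.symm.isLink_iff_sym2_eq]
      simp [hne, eq_comm]
    · by_cases hfe' : f = e'
      · subst hfe'
        rw [hy.isLink_iff_sym2_eq]
        simp [hfe, eq_comm]
      · simp [hfe, hfe']

theorem IsColoredSubdivision.exists_forall_branch {K : Graph α β} {c : β → Fin 3}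
    (hfin : V(K).Finite) (hK : K.IsColoredSubdivision c) :
    ∃ H : Graph α β, H.IsColoredSubdivision c ∧ (∀ v ∈ V(H), H.IsBranchVertex c v) ∧
      Relation.ReflTransGen IsElementarySubdivision H K := by
  induction hn : V(K).ncard generalizing K with
  | zero =>
    obtain ⟨v, hv, -⟩ := hK.exists_branch
    rw [Set.ncard_eq_zero hfin] at hn
    exact absurd (hn ▸ hv) (Set.notMem_empty v)
  | succ n ih =>
    by_cases hall : ∀ v ∈ V(K), K.IsBranchVertex c v
    · exact ⟨K, hK, hall, .refl⟩
    · push Not at hall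
      obtain ⟨w, hw, hwb⟩ := hall
      obtain ⟨H, hH, hHV, hHK⟩ := hK.exists_suppress hw
        ((hK.branch_or_thread w hw).resolve_left hwb)
      obtain ⟨H', hH', hb, hH'H⟩ := ih (K := H) (hHV ▸ hfin.subset Set.sdiff_subset) hH (by
        rw [hHV, Set.ncard_sdiff_singleton_of_mem hw, hn]
        rfl)
      exact ⟨H', hH', hb, hH'H.tail hHK⟩

theorem IsColoredSubdivision.isConnected {K : Graph α β} {c : β → Fin 3}
    (hK : K.IsColoredSubdivision c) : K.IsConnected := by
  obtain ⟨v, hv, -⟩ := hK.exists_branch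
  refine ⟨⟨v, hv⟩, fun x hx y hy => ?_⟩
  have := hK.connected {z | z ∈ V(K) ∧ K.Reachable x z} (fun z hz => hz.1)
    ⟨x, hx, Relation.ReflTransGen.refl⟩ (fun e u v h hu => ⟨h.right_mem, hu.2.tail h.adj⟩)
  rw [← this] at hy
  exact hy.2

theorem degree_eq_three {K : Graph α β} [K.Loopless] {c : β → Fin 3} {v : α}
    (h : K.IsBranchVertex c v) : K.degree v = 3 := by
  obtain ⟨e, he, hinc⟩ := h
  have h1 : {f | K.IsNonloopAt f v} = Set.range e := by
    ext f
    constructor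
    · intro hf
      obtain ⟨i, rfl⟩ := (hinc f).1 (IsNonloopAt.inc hf)
      exact ⟨i, rfl⟩
    · rintro ⟨i, rfl⟩
      exact ((hinc _).2 ⟨i, rfl⟩).isNonloopAt
  have h2 : {f | K.IsLoopAt f v} = ∅ := by
    ext f
    simp
  have hinj : Function.Injective e := Function.LeftInverse.injective he
  rw [degree, h1, h2, ← Set.image_univ, hinj.encard_image]
  simp

/-- Once all thread vertices are suppressed, every vertex sees each color exactly once, so `c`
itself is the proper coloring. -/
theorem IsColoredSubdivision.exists_cubic {K : Graph α β} {c : β → Fin 3}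
    (hfin : V(K).Finite) (hK : K.IsColoredSubdivision c) :
    ∃ H : Graph α β, H.IsCubic ∧ H.IsConnected ∧ H.IsEdgeColorable 3 ∧ H.IsSubdivision K := by
  obtain ⟨H, hH, hb, hHK⟩ := hK.exists_forall_branch hfin
  have := hH.loopless
  refine ⟨H, fun v hv => degree_eq_three (hb v hv), hH.isConnected, ⟨hH.loopless, c, ?_⟩,
    H, ⟨Equiv.refl _, Equiv.refl _, fun _ _ _ => Iff.rfl⟩, hHK⟩
  intro e f v he hf hne hc
  exact hne ((hb v he.vertex_mem).eq_of_color_eq he hf hc)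

end Graph

/-! ### Translation between `Graph` and end maps -/

namespace Graph

open scoped Graph
open EndMaps

variable {α β : Type*} {G : Graph α β}

/-- The maps `a` and `b` choose the two ends of every edge. -/
def AreEndMaps (G : Graph α β) (a b : E(G) → V(G)) : Prop :=
  ∀ e : E(G), G.IsLink e (a e) (b e)

theorem exists_areEndMaps (G : Graph α β) : ∃ a b, G.AreEndMaps a b := by
  choose a b h using fun e : E(G) => exists_isLink_of_mem_edgeSet e.2
  exact ⟨fun e => ⟨a e, (h e).left_mem⟩, fun e => ⟨b e, (h e).right_mem⟩, h⟩

variable {a b : E(G) → V(G)}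

theorem AreEndMaps.inc_iff (hab : G.AreEndMaps a b) {e : E(G)} {v : V(G)} :
    G.Inc e v ↔ a e = v ∨ b e = v := by
  constructor
  · intro h
    exact (h.eq_or_eq_of_isLink (hab e)).imp (fun h => (Subtype.ext h).symm)
      (fun h => (Subtype.ext h).symm)
  · rintro (rfl | rfl)
    · exact (hab e).inc_left
    · exact (hab e).inc_right

theorem AreEndMaps.isLoopAt_iff (hab : G.AreEndMaps a b) {e : E(G)} {v : V(G)} :
    G.IsLoopAt e v ↔ a e = v ∧ b e = v := by
  constructor
  · intro h
    exact ⟨Subtype.ext (h.eq_of_inc (hab e).inc_left).symm,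
      Subtype.ext (h.eq_of_inc (hab e).inc_right).symm⟩
  · rintro ⟨rfl, h⟩
    have := hab e
    rwa [h] at this

/-- The degree in a subgraph of `G` in terms of end maps of `G`. -/
theorem AreEndMaps.degree_eq [DecidableEq V(G)] (hab : G.AreEndMaps a b) {H : Graph α β}
    (hH : H ≤ G) (D : Finset E(G)) (v : V(G))
    (hD : ∀ e : E(G), H.Inc e v ↔ e ∈ D ∧ G.Inc e v) : H.degree v = endDegree a b D v := by
  have hloop : ∀ e : E(G), H.IsLoopAt e v ↔ e ∈ D ∧ a e = v ∧ b e = v := by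
    intro e
    rw [← hab.isLoopAt_iff]
    constructor
    · intro h
      exact ⟨((hD e).1 h.inc).1, h.mono hH⟩
    · rintro ⟨h1, h2⟩
      exact (hH.isLoopAt_congr ((hD e).2 ⟨h1, h2.inc⟩).edge_mem).2 h2
  have h1 : {e | H.IsLoopAt e v} = Subtype.val ''
      ((D.filter fun e => a e = v ∧ b e = v : Finset E(G)) : Set E(G)) := by
    ext e
    constructor
    · intro he
      have he' := IsLoopAt.edge_mem (IsLoopAt.mono hH he)
      exact ⟨⟨e, he'⟩, by simpa using (hloop ⟨e, he'⟩).1 he, rfl⟩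
    · rintro ⟨e, he, rfl⟩
      exact (hloop e).2 (by simpa using he)
  have h2 : {e | H.IsNonloopAt e v} = Subtype.val ''
      ((D.filter fun e => ¬(a e = v ↔ b e = v) : Finset E(G)) : Set E(G)) := by
    have hn : ∀ e : E(G), H.IsNonloopAt e v ↔ e ∈ D ∧ ¬(a e = v ↔ b e = v) := by
      intro e
      rw [isNonloopAt_iff_inc_not_isLoopAt, hloop, hD, hab.inc_iff]
      tauto
    ext e
    constructor
    · intro he
      have he' := Inc.edge_mem (Inc.mono hH (IsNonloopAt.inc he))
      exact ⟨⟨e, he'⟩, by simpa using (hn ⟨e, he'⟩).1 he, rfl⟩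
    · rintro ⟨e, he, rfl⟩
      exact (hn e).2 (by simpa using he)
  have h3 : endDegree a b D v = (D.filter fun e => ¬(a e = v ↔ b e = v)).card +
      2 * (D.filter fun e => a e = v ∧ b e = v).card := by
    rw [endDegree, Finset.card_filter, Finset.card_filter, Finset.mul_sum,
      ← Finset.sum_add_distrib]
    refine Finset.sum_congr rfl fun e _ => ?_
    by_cases h1 : a e = v <;> by_cases h2 : b e = v <;> simp [h1, h2]
  rw [degree, h1, h2, Subtype.val_injective.encard_image, Subtype.val_injective.encard_image,
    Set.encard_coe_eq_coe_finsetCard, Set.encard_coe_eq_coe_finsetCard, h3]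
  push_cast
  rfl

theorem Reachable.mem_of_closed {x y : α} (h : G.Reachable x y) {X : Set α} (hx : x ∈ X)
    (hX : ∀ u v, G.Adj u v → u ∈ X → v ∈ X) : y ∈ X := by
  induction h with
  | refl => exact hx
  | tail _ h ih => exact hX _ _ h ih

theorem Reachable.symm {x y : α} (h : G.Reachable x y) : G.Reachable y x := by
  induction h with
  | refl => exact .refl
  | tail _ h ih => exact .head h.symm ih

/-- A nonempty union of circuits contains a circuit, in the sense of subgraphs. -/
theorem AreEndMaps.exists_isCircuit [DecidableEq V(G)] (hV : V(G).Finite)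
    (hab : G.AreEndMaps a b) {C : Finset E(G)} (hC : IsCircuitUnion a b C) :
    ∃ H : Graph α β, H.IsCircuit ∧ H ≤ G.restrict (Subtype.val '' (C : Set E(G))) ∧
      ∃ e ∈ C, (a e : α) ∈ V(H) := by
  obtain ⟨⟨e₀, he₀⟩, hdeg⟩ := hC
  set R := G.restrict (Subtype.val '' (C : Set E(G))) with hR
  have hRG : R ≤ G := restrict_le
  -- One component of the union. Each of its vertices meets an edge of `C`, so its degree is 2 and
  -- not 0.
  set Y : Set α := {z | R.Reachable (a e₀) z} with hY
  have hYV : Y ⊆ V(G) := fun z hz => hz.mem_of_closed (X := V(G)) (a e₀).2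
    fun u v huv _ => huv.right_mem
  have hYcl : ∀ u v, R.Adj u v → u ∈ Y → v ∈ Y := fun u v huv hu => hu.tail huv
  have hRinc : ∀ e : E(G), ∀ v, R.Inc e v ↔ e ∈ C ∧ G.Inc e v := by
    intro e v
    rw [hR, restrict_inc, and_comm]
    simp
  set H := R.induce Y with hH
  have hHR : H ≤ R := induce_le hYV
  have hHinc : ∀ e : β, ∀ v ∈ Y, H.Inc e v ↔ R.Inc e v := by
    intro e v hv
    refine ⟨fun h => h.mono hHR, ?_⟩
    rintro ⟨u, hu⟩
    exact ⟨u, hu, hv, hYcl v u hu.adj hv⟩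
  have hreach : ∀ z ∈ Y, H.Reachable (a e₀) z := by
    intro z hz
    have : z ∈ {z | z ∈ Y ∧ H.Reachable (a e₀) z} := by
      refine hz.mem_of_closed ⟨.refl, .refl⟩ ?_
      rintro u v ⟨e, he⟩ ⟨h1, h2⟩
      have h3 := hYcl u v he.adj h1
      exact ⟨h3, h2.tail ⟨e, he, h1, h3⟩⟩
    exact this.2
  refine ⟨H, ⟨hV.subset hYV, ⟨⟨_, .refl⟩, fun x hx y hy =>
    (hreach x hx).symm.trans (hreach y hy)⟩, ?_⟩, hHR, e₀, he₀, .refl⟩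
  intro v hv
  have hd := hab.degree_eq (hHR.trans hRG) C ⟨v, hYV hv⟩ (fun e => by
    rw [hHinc e v hv, hRinc])
  rw [hd]
  have hinc : ∃ e ∈ C, G.Inc e v := by
    refine hv.mem_of_closed (X := {v | ∃ e ∈ C, G.Inc e v}) ⟨e₀, he₀, (hab e₀).inc_left⟩ ?_
    rintro u v ⟨e, he⟩ -
    obtain ⟨⟨f, hf, rfl⟩, h⟩ := he
    exact ⟨f, hf, h.inc_right⟩
  obtain ⟨e, he, hev⟩ := hinc
  have hne : endDegree a b C ⟨v, hYV hv⟩ ≠ 0 := by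
    intro h0
    rw [endDegree, Finset.sum_eq_zero_iff] at h0
    have := h0 e he
    rcases (hab.inc_iff (v := ⟨v, hYV hv⟩)).1 hev with h | h <;> simp [h] at this
  rw [(hdeg _).resolve_left hne]

/-- Deleting the edge cut of `X` leaves no walk out of `X`, so the circuits found on its two sides
lie in different components. -/
theorem AreEndMaps.cyclicCutsGe [DecidableEq V(G)] [DecidableEq E(G)] [Fintype V(G)]
    [Fintype E(G)] (hV : V(G).Finite)
    (hab : G.AreEndMaps a b) {k : ℕ} (hcyc : G.IsCyclicallyEdgeConnected k) :
    CyclicCutsGe a b k := by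
  intro X C D hC hD hCX hDX
  by_contra hlt
  push Not at hlt
  obtain ⟨H, hH, hHle, e, he, heH⟩ := hab.exists_isCircuit hV hC
  obtain ⟨J, hJ, hJle, f, hf, hfJ⟩ := hab.exists_isCircuit hV hD
  set S : Set β := Subtype.val '' (edgeCut a b X : Set E(G)) with hS
  have hmem : ∀ e : E(G), (e : β) ∈ S ↔ ¬(a e ∈ X ↔ b e ∈ X) := by
    intro e
    rw [← mem_edgeCut]
    simp [hS]
  have hle : ∀ D : Finset E(G), (∀ e ∈ D, (a e ∈ X ↔ b e ∈ X)) →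
      G.restrict (Subtype.val '' (D : Set E(G))) ≤ G.deleteEdges S := by
    intro D hD
    refine ⟨subset_rfl, ?_⟩
    rintro _ x y ⟨⟨e, he, rfl⟩, h⟩
    exact ⟨h, fun h' => (hmem e).1 h' (hD e he)⟩
  have hreach := hcyc S (by rintro _ ⟨e, -, rfl⟩; exact e.2) (by
    rw [hS, Subtype.val_injective.encard_image, Set.encard_coe_eq_coe_finsetCard]
    exact_mod_cast hlt) H J hH hJ
    (hHle.trans (hle C fun e he => iff_of_true (hCX e he).1 (hCX e he).2))
    (hJle.trans (hle D fun e he => iff_of_false (hDX e he).1 (hDX e he).2)) _ heH _ hfJ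
  have : (a f : α) ∈ Subtype.val '' (X : Set V(G)) := by
    refine hreach.mem_of_closed ⟨a e, (hCX e he).1, rfl⟩ ?_
    rintro u v ⟨g, hg, hgS⟩ ⟨u, hu, rfl⟩
    have hgX := not_not.1 (mt (hmem ⟨g, hg.edge_mem⟩).2 hgS)
    have hu' := (hab.inc_iff (e := ⟨g, hg.edge_mem⟩) (v := u)).1 hg.inc_left
    have hv' := (hab.inc_iff (e := ⟨g, hg.edge_mem⟩) (v := ⟨v, hg.right_mem⟩)).1 hg.inc_right
    refine ⟨⟨v, hg.right_mem⟩, ?_, rfl⟩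
    rw [Finset.mem_coe] at hu ⊢
    rcases hu' with h' | h' <;> rcases hv' with h | h <;> rw [← h] <;> rw [← h'] at hu <;> tauto
  obtain ⟨w, hw, hwf⟩ := this
  rw [Subtype.ext hwf] at hw
  exact (hDX f hf).1 hw

/-- For a bridge `e`, the component of one end after deletion of `e` would have a cut contained in
`{e}`. -/
theorem AreEndMaps.isBridgeless [DecidableEq V(G)] [Fintype V(G)] [Fintype E(G)]
    (hab : G.AreEndMaps a b)
    (hconn : ∀ X : Finset V(G), X.Nonempty → X ≠ Finset.univ → 2 ≤ (edgeCut a b X).card) :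
    G.IsBridgeless := by
  classical
  intro e x y hxy
  by_contra hne
  set X : Finset V(G) := Finset.univ.filter fun z => (G.deleteEdges {e}).Reachable x z with hX
  have h2 := hconn X ⟨⟨x, hxy.left_mem⟩, Finset.mem_filter.2 ⟨Finset.mem_univ _, .refl⟩⟩ (by
    intro h
    have : (⟨y, hxy.right_mem⟩ : V(G)) ∈ X := h ▸ Finset.mem_univ _
    exact hne (Finset.mem_filter.1 this).2)
  have hsub : edgeCut a b X ⊆ {⟨e, hxy.edge_mem⟩} := by
    intro f hf
    rw [Finset.mem_singleton]
    by_contra hfe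
    have hadj : (G.deleteEdges {e}).Adj (a f) (b f) :=
      ⟨f, hab f, fun h => hfe (Subtype.ext h)⟩
    rw [mem_edgeCut] at hf
    refine hf ?_
    simp only [hX, Finset.mem_filter, Finset.mem_univ, true_and]
    exact ⟨fun h => h.tail hadj, fun h => h.tail hadj.symm⟩
  have := Finset.card_le_card hsub
  rw [Finset.card_singleton] at this
  omega

theorem AreEndMaps.exists_isColoredSubdivision [DecidableEq V(G)] [Fintype V(G)] [Fintype E(G)]
    (hab : G.AreEndMaps a b) (hl : ∀ e, a e ≠ b e) {S : Finset E(G)} {c : E(G) → Fin 3}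
    (hS : Connects a b S)
    (hlocal : ∀ v, (∃ e : Fin 3 → E(G), (∀ i, c (e i) = i) ∧
        ∀ f, (f ∈ S ∧ (a f = v ∨ b f = v)) ↔ ∃ i, f = e i) ∨
      ∃ e f, e ≠ f ∧ c e = c f ∧ ∀ g, (g ∈ S ∧ (a g = v ∨ b g = v)) ↔ g = e ∨ g = f)
    (hbranch : ∃ v, ∃ e : Fin 3 → E(G), (∀ i, c (e i) = i) ∧
        ∀ f, (f ∈ S ∧ (a f = v ∨ b f = v)) ↔ ∃ i, f = e i) :
    ∃ c' : β → Fin 3, (G.restrict (Subtype.val '' (S : Set E(G)))).IsColoredSubdivision c' := by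
  classical
  set K := G.restrict (Subtype.val '' (S : Set E(G))) with hK
  -- The color 0 of labels that are not edges of `G` is immaterial.
  let c' : β → Fin 3 := fun e => if h : e ∈ E(G) then c ⟨e, h⟩ else 0
  have hc' : ∀ e : E(G), c' e = c e := fun e => dif_pos e.2
  have hKinc : ∀ e : E(G), ∀ v : V(G), K.Inc e v ↔ e ∈ S ∧ (a e = v ∨ b e = v) := by
    intro e v
    rw [hK, restrict_inc, and_comm, hab.inc_iff]
    simp
  have hbr : ∀ v : V(G), (∃ e : Fin 3 → E(G), (∀ i, c (e i) = i) ∧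
        ∀ f, (f ∈ S ∧ (a f = v ∨ b f = v)) ↔ ∃ i, f = e i) → K.IsBranchVertex c' v := by
    rintro v ⟨e, he, hinc⟩
    refine ⟨fun i => e i, fun i => (hc' _).trans (he i), fun f => ⟨fun hf => ?_, ?_⟩⟩
    · have hfE := (hf.mono (restrict_le (E₀ := Subtype.val '' (S : Set E(G))))).edge_mem
      obtain ⟨i, hi⟩ := (hinc ⟨f, hfE⟩).1 ((hKinc ⟨f, hfE⟩ v).1 hf)
      exact ⟨i, congrArg Subtype.val hi⟩
    · rintro ⟨i, rfl⟩
      exact (hKinc _ _).2 ((hinc _).2 ⟨i, rfl⟩)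
  refine ⟨c', ⟨⟨?_⟩, ?_, ?_, ?_⟩⟩
  · intro e x h
    have hG : G.IsLoopAt e x := h.mono restrict_le
    have := (hab.isLoopAt_iff (e := ⟨e, hG.edge_mem⟩) (v := ⟨x, hG.vertex_mem⟩)).1 hG
    exact hl _ (this.1.trans this.2.symm)
  · intro X hX ⟨x, hx⟩ hcl
    have hu := hS (Finset.univ.filter fun v => (v : α) ∈ X) ⟨⟨x, hX hx⟩, by simpa using hx⟩ (by
      intro e he
      have hlink : K.IsLink e (a e) (b e) := ⟨⟨e, he, rfl⟩, hab e⟩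
      simp only [Finset.mem_filter, Finset.mem_univ, true_and]
      exact ⟨hcl _ _ _ hlink, hcl _ _ _ hlink.symm⟩)
    refine hX.antisymm fun v hv => ?_
    exact (Finset.mem_filter.1 (Finset.eq_univ_iff_forall.1 hu ⟨v, hv⟩)).2
  · intro v hv
    refine (hlocal ⟨v, hv⟩).imp (hbr ⟨v, hv⟩) ?_
    rintro ⟨e, f, hne, hc, hinc⟩
    refine ⟨e, f, fun h => hne (Subtype.ext h), by rw [hc', hc', hc], fun g => ⟨fun hg => ?_, ?_⟩⟩
    · have hgE := (hg.mono (restrict_le (E₀ := Subtype.val '' (S : Set E(G))))).edge_mem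
      exact ((hinc ⟨g, hgE⟩).1 ((hKinc ⟨g, hgE⟩ ⟨v, hv⟩).1 hg)).imp (congrArg Subtype.val)
        (congrArg Subtype.val)
    · rintro (rfl | rfl)
      · exact (hKinc _ ⟨v, hv⟩).2 ((hinc _).2 (Or.inl rfl))
      · exact (hKinc _ ⟨v, hv⟩).2 ((hinc _).2 (Or.inr rfl))
  · obtain ⟨v, hv⟩ := hbranch
    exact ⟨v, v.2, hbr v hv⟩

end Graph

theorem mainTheorem2 {α β : Type*} (G : Graph α β)
    (hne : G.vertexSet.Nonempty) (hV : G.vertexSet.Finite) (hE : G.edgeSet.Finite)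
    (hcubic : G.IsCubic) (hcyc : G.IsCyclicallyEdgeConnected 4) :
    G.IsBridgeless ∧
      ∃ H : Graph α β, H.IsCubic ∧ H.IsConnected ∧ H.IsEdgeColorable 3 ∧ H.IsSpanningMinor G := by
  classical
  have := hV.fintype
  have := hE.fintype
  have := hne.to_subtype
  obtain ⟨a, b, hab⟩ := G.exists_areEndMaps
  have hcub : ∀ v, EndMaps.endDegree a b Finset.univ v = 3 := by
    intro v
    have h := hab.degree_eq le_rfl Finset.univ v (by simp)
    rw [hcubic v v.2] at h
    exact_mod_cast h.symm
  have hcuts := hab.cyclicCutsGe hV hcyc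
  have hconn : ∀ X : Finset G.vertexSet, X.Nonempty → X ≠ Finset.univ →
      2 ≤ (EndMaps.edgeCut a b X).card :=
    fun X hX hX' => EndMaps.two_le_card_edgeCut hcub hcuts hX hX'
  refine ⟨hab.isBridgeless hconn, ?_⟩
  obtain ⟨S, c, hS, hlocal, hbranch⟩ := EndMaps.exists_coloring hcub hcuts
  obtain ⟨c', hK⟩ := hab.exists_isColoredSubdivision
    (EndMaps.loopless_of_two_le_card_edgeCut hcub hconn) hS hlocal hbranch
  obtain ⟨H, h1, h2, h3, h4⟩ := hK.exists_cubic (by exact hV)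
  exact ⟨H, h1, h2, h3, _, h4, Graph.restrict_le, rfl⟩
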